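/- Consider the symmetric two-user real Gaussian interference channel $Y_1=X_1+hX_2+Z_1$, $Y_2=X_2+hX_1+Z_2$, where $h\in\mathbb R$, the noises $Z_1,Z_2$ are independent standard Gaussian random variables, i.i.d. in time, and each user has power constraint $P\ge 0$. A code of block length $n$ and rate $R_i$ for user $i$ consists of codewords $x_i(m)\in\mathbb R^n$ with $\|x_i(m)\|^2\le nP$, one for each message $m\in\{1,\dots,\lfloor 2^{nR_i}\rfloor\}$, and a measurable decoder $g_i$ from $\mathbb R^n$ to the messages. A pair $(R_1,R_2)$ with $R_1,R_2\ge 0$ is achievable if there is a sequence of such pairs of codes, $n=0,1,2,\dots$, for which, with independent uniformly distributed messages $m_1,m_2$, both error probabilities $\Pr[g_i(Y_i^n)\ne m_i]$, $i=1,2$, tend to $0$ as $n\to\infty$. The sum capacity $C_{\rm sum}$ is the supremum of $R_1+R_2$ over all achievable pairs. Let $\Gamma\subset\mathbb R^2$ be the curve of all points $(\eta\cos\theta,\eta\sin\theta)$ with $\eta>0$, $\theta\in\mathbb R$ and $$h^2\eta^2+(1+h^2P)\cos^2\theta=1 .$$ Theorem. Suppose that $|h+h^3P|>1/2$. Then there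 are exactly two non-vertical lines through the point $(\sqrt{1+h^2P},0)$ that are tangent to $\Gamma$, and their slopes are $\mu$ and $-\mu$ for some $\mu>0$. For this slope $\mu$ (the sign is immaterial), $$C_{\rm sum}\le\log_2\left[1+\frac{P}{1+h^2P}\left(1+\frac1{\mu^2}\right)\right].$$ -/

import Mathlib

/-! # The two-user Gaussian interference channel and the useful-genie curve -/

namespace GaussIC

open MeasureTheory ProbabilityTheory Filter

noncomputable section

/-- A block code of length `n` with `M` messages and power constraint `P` for one user:
an encoder whose codewords satisfy `‖x(m)‖² ≤ n P`, and a (measurable) decoder. -/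
structure Code (n M : ℕ) (P : ℝ) where
  /-- the encoding function -/
  enc : Fin M → Fin n → ℝ
  /-- the decoding function -/
  dec : (Fin n → ℝ) → Fin M
  /-- every codeword satisfies the power constraint -/
  power_le : ∀ m, ∑ k, enc m k ^ 2 ≤ n * P
  /-- the decision regions are measurable -/
  measurable_dec : Measurable dec

/-- The law of `n` i.i.d. standard Gaussian noise samples. -/
def noise (n : ℕ) : Measure (Fin n → ℝ) :=
  Measure.pi fun _ => gaussianReal 0 1

/-- The joint law of `(m₁, m₂, Z₁ⁿ, Z₂ⁿ)`: uniform messages and standard Gaussian noises,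
all independent. -/
def law (n M₁ M₂ : ℕ) : Measure (Fin M₁ × Fin M₂ × (Fin n → ℝ) × (Fin n → ℝ)) :=
  (uniformOn (Set.univ : Set (Fin M₁))).prod
    ((uniformOn (Set.univ : Set (Fin M₂))).prod ((noise n).prod (noise n)))

section Channel

variable {n M₁ M₂ : ℕ} {P₁ P₂ : ℝ}

/-- Received block `Y₁ⁿ = X₁ⁿ + h₁₂ X₂ⁿ + Z₁ⁿ`. -/
def output₁ (h₁₂ : ℝ) (c₁ : Code n M₁ P₁) (c₂ : Code n M₂ P₂)
    (ω : Fin M₁ × Fin M₂ × (Fin n → ℝ) × (Fin n → ℝ)) : Fin n → ℝ :=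
  fun k => c₁.enc ω.1 k + h₁₂ * c₂.enc ω.2.1 k + ω.2.2.1 k

/-- Received block `Y₂ⁿ = X₂ⁿ + h₂₁ X₁ⁿ + Z₂ⁿ`. -/
def output₂ (h₂₁ : ℝ) (c₁ : Code n M₁ P₁) (c₂ : Code n M₂ P₂)
    (ω : Fin M₁ × Fin M₂ × (Fin n → ℝ) × (Fin n → ℝ)) : Fin n → ℝ :=
  fun k => c₂.enc ω.2.1 k + h₂₁ * c₁.enc ω.1 k + ω.2.2.2 k

/-- Error probability `Pr[m₁ ≠ g₁(Y₁ⁿ)]` of user 1. -/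
def errorProb₁ (h₁₂ : ℝ) (c₁ : Code n M₁ P₁) (c₂ : Code n M₂ P₂) : ℝ :=
  (law n M₁ M₂).real {ω | c₁.dec (output₁ h₁₂ c₁ c₂ ω) ≠ ω.1}

/-- Error probability `Pr[m₂ ≠ g₂(Y₂ⁿ)]` of user 2. -/
def errorProb₂ (h₂₁ : ℝ) (c₁ : Code n M₁ P₁) (c₂ : Code n M₂ P₂) : ℝ :=
  (law n M₁ M₂).real {ω | c₂.dec (output₂ h₂₁ c₁ c₂ ω) ≠ ω.2.1}

end Channel

/-- The number of messages `2^{nR}` at rate `R` (bits per channel use) and block length `n`,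
rounded down to an integer. -/
def numMessages (n : ℕ) (R : ℝ) : ℕ := ⌊(2 : ℝ) ^ ((n : ℝ) * R)⌋₊

/-- `(R₁, R₂)` is achievable if some sequence of pairs of codes with `2^{nR₁}` and `2^{nR₂}`
messages has both error probabilities tending to zero. -/
def Achievable (h₁₂ h₂₁ P₁ P₂ R₁ R₂ : ℝ) : Prop :=
  0 ≤ R₁ ∧ 0 ≤ R₂ ∧
    ∃ (c₁ : ∀ n : ℕ, Code n (numMessages n R₁) P₁)
      (c₂ : ∀ n : ℕ, Code n (numMessages n R₂) P₂),
      Tendsto (fun n => errorProb₁ h₁₂ (c₁ n) (c₂ n)) atTop (nhds 0) ∧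
      Tendsto (fun n => errorProb₂ h₂₁ (c₁ n) (c₂ n)) atTop (nhds 0)

/-- The sum capacity: the supremum of `R₁ + R₂` over all achievable rate pairs, in the extended
reals (so that it is `⊤` when the sum rates are unbounded). -/
def sumCapacity (h₁₂ h₂₁ P₁ P₂ : ℝ) : EReal :=
  ⨆ (R₁ : ℝ) (R₂ : ℝ) (_ : Achievable h₁₂ h₂₁ P₁ P₂ R₁ R₂), ((R₁ + R₂ : ℝ) : EReal)

/-- The boundary curve of the useful-genie region, in Cartesian coordinates: the points with polar
coordinates `(η, θ)`, `η > 0`, such that `h²η² + (1 + h²P) cos²θ = 1`. -/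
def usefulGenieCurve (h P : ℝ) : Set (ℝ × ℝ) :=
  {q | ∃ η θ : ℝ, 0 < η ∧ h ^ 2 * η ^ 2 + (1 + h ^ 2 * P) * Real.cos θ ^ 2 = 1 ∧
    q = (η * Real.cos θ, η * Real.sin θ)}

/-- `μ` is the slope of a line through `(√(1 + h²P), 0)` that is tangent to the useful-genie curve:
the line passes through a point `q` of the curve, and its direction `(1, μ)` is a tangent
direction of the curve at `q`. -/
def IsTangentSlope (h P μ : ℝ) : Prop :=
  ∃ q ∈ usefulGenieCurve h P,
    q.2 = μ * (q.1 - √(1 + h ^ 2 * P)) ∧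
    ((1, μ) : ℝ × ℝ) ∈ tangentConeAt ℝ (usefulGenieCurve h P) q

end

end GaussIC

/-! # A genie-aided bound on the sum capacity and the tangents to the useful-genie curve

*The capacity bound.* Fix a point `(x, y) = (η cos θ, η sin θ)` of the curve and put
`s = √(1 + h²P)`, `ρ = s cos θ`, so that `ρ² + h²η² = 1`. With independent standard Gaussian vectors
`W₁, W₂`, the channel noises may be written `ρ W₁ + h η W₂` and `ρ W₂ + h η W₁`; only the marginal
law of each enters the error probabilities. A genie gives receiver `i` the signal `Sᵢ = Xᵢ + η Wᵢ`,
so that `Y₁ = X₁ + ρ W₁ + h S₂`: once `X₁` and `S₁` are known, what is left of `Y₁` is `h S₂`.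

No differential entropies are used. Let `rᵢ` be the ratio of a reference density `q(yᵢ, sᵢ)` to the
conditional density of `(Yᵢ, Sᵢ)` given `Xᵢ` (`genieRatio`); here `q` gives `Sᵢ` its true density
`gᵢ` and makes `Yᵢ` Gaussian around an affine function of `Sᵢ`. If `Fᵢ` is `Mᵢ` on correct decoding
and `1` otherwise, then `E[Fᵢ rᵢ] ≤ 2` (`lintegral_mul_genieRatio_le`), and
`log t ≤ log 2 - 1 + t / 2` gives `E[log (F₁ r₁ F₂ r₂)] ≤ 2 log 2`. In the product `r₁ r₂` the unknown densities `g₁, g₂`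
cancel, because `gⱼ` also occurs in the denominator of `rᵢ` as the density of the interference.
What remains is Gaussian and needs second moments only (`log_card_le`). This yields
`C_sum ≤ log₂ (V / (h²η²))` with `V` the mean square error of a linear estimate of `Y` from `S`
(`sumCapacity_le`), and for the best estimate `V / (h²η²) = 1 + P / s² * (1 + 1 / μ²)`, with `μ` the
slope of the line through `(x, y)` and `(s, 0)` (`sumCapacity_le_of_mem_curve`).

*The tangents.* The curve is the zero set, away from the origin, of
`h²(x² + y²)² + h²P x² - y²`, and its tangent cones are the kernels of the gradient of this
polynomial. By Euler's identity the tangent at `(x, y)` passes through `(s, 0)` iff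
`h²(x² + y²)² = s x (2h²(x² + y²) + h²P)`; in terms of `A = h²(x² + y²)` this becomes
`A³ = h²(1 - A)(2A + h²P)²`, which has exactly one positive root (`cubic_unique`, `cubic_exists`).
Hence there are two mirror-image points of tangency. The hypothesis `|h + h³P| > 1/2` keeps the curve off
the vertical line through `(s, 0)`, so that neither tangent is vertical.
-/

namespace GaussIC

open MeasureTheory ProbabilityTheory Filter
open scoped ENNReal

noncomputable section

/-! ### Gaussian noise and its density -/

instance isProbabilityMeasure_noise (n : ℕ) : IsProbabilityMeasure (noise n) := by
  unfold noise; infer_instance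

/-- The density of `n` i.i.d. standard Gaussian samples. -/
def stdPDF (n : ℕ) (z : Fin n → ℝ) : ℝ := ∏ k, gaussianPDFReal 0 1 (z k)

lemma stdPDF_pos {n : ℕ} (z : Fin n → ℝ) : 0 < stdPDF n z :=
  Finset.prod_pos fun _ _ => gaussianPDFReal_pos _ _ _ one_ne_zero

@[fun_prop]
lemma measurable_stdPDF (n : ℕ) : Measurable (stdPDF n) := by
  unfold stdPDF
  exact Finset.measurable_prod _ fun k _ =>
    (measurable_gaussianPDFReal 0 1).comp (measurable_pi_apply k)

lemma log_stdPDF {n : ℕ} (z : Fin n → ℝ) :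
    Real.log (stdPDF n z) = -(n * (Real.log (2 * Real.pi) / 2)) - (∑ k, z k ^ 2) / 2 := by
  have h1 : ∀ x : ℝ,
      Real.log (gaussianPDFReal 0 1 x) = -(Real.log (2 * Real.pi) / 2) - x ^ 2 / 2 := by
    intro x
    have : (0 : ℝ) < √(2 * Real.pi) := by positivity
    rw [gaussianPDFReal, Real.log_mul (by positivity) (Real.exp_pos _).ne', Real.log_exp,
      Real.log_inv]
    simp only [NNReal.coe_one, mul_one, sub_zero]
    rw [Real.log_sqrt (by positivity)]
    ring
  rw [stdPDF, Real.log_prod fun k _ => (gaussianPDFReal_pos _ _ _ one_ne_zero).ne']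
  simp only [h1, Finset.sum_sub_distrib, Finset.sum_const, Finset.card_univ, Fintype.card_fin,
    nsmul_eq_mul, Finset.sum_div]
  ring

lemma noise_eq_withDensity (n : ℕ) :
    noise n = (volume : Measure (Fin n → ℝ)).withDensity fun z => ENNReal.ofReal (stdPDF n z) := by
  unfold noise
  refine Measure.pi_eq fun s hs => ?_
  have hind : ∀ z : Fin n → ℝ, (Set.univ.pi s).indicator (stdPDF n) z
      = ∏ k, (s k).indicator (gaussianPDFReal 0 1) (z k) := by
    intro z
    by_cases hz : z ∈ Set.univ.pi s
    · rw [Set.indicator_of_mem hz, stdPDF]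
      exact Finset.prod_congr rfl fun k _ =>
        (Set.indicator_of_mem (hz k (Set.mem_univ k)) _).symm
    · rw [Set.indicator_of_notMem hz]
      simp only [Set.mem_pi, Set.mem_univ, true_implies, not_forall] at hz
      obtain ⟨k, hk⟩ := hz
      exact (Finset.prod_eq_zero (Finset.mem_univ k) (Set.indicator_of_notMem hk _)).symm
  have hi : ∀ k, Integrable ((s k).indicator (gaussianPDFReal 0 1)) volume := fun k =>
    (integrable_gaussianPDFReal 0 1).indicator (hs k)
  have hI : Integrable ((Set.univ.pi s).indicator (stdPDF n)) volume := by
    have := Integrable.fintype_prod (μ := fun _ : Fin n => (volume : Measure ℝ)) hi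
    rwa [← volume_pi, ← funext hind] at this
  rw [withDensity_apply _ (MeasurableSet.univ_pi hs),
    ← lintegral_indicator (MeasurableSet.univ_pi hs)]
  have e1 : ∀ z : Fin n → ℝ, (Set.univ.pi s).indicator (fun z => ENNReal.ofReal (stdPDF n z)) z
      = ENNReal.ofReal ((Set.univ.pi s).indicator (stdPDF n) z) := by
    intro z
    by_cases hz : z ∈ Set.univ.pi s <;> simp [hz]
  simp only [e1]
  rw [← ofReal_integral_eq_lintegral_ofReal hI
    (ae_of_all _ (Set.indicator_nonneg fun z _ => (stdPDF_pos z).le))]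
  simp only [hind]
  rw [integral_fintype_prod_volume_eq_prod, ENNReal.ofReal_prod_of_nonneg
    fun k _ => integral_nonneg (Set.indicator_nonneg fun z _ => gaussianPDFReal_nonneg _ _ _)]
  refine Finset.prod_congr rfl fun k _ => ?_
  rw [integral_indicator (hs k), gaussianReal_apply_eq_integral _ one_ne_zero]

lemma lintegral_noise {n : ℕ} {f : (Fin n → ℝ) → ℝ≥0∞} (hf : Measurable f) :
    ∫⁻ z, f z ∂noise n = ∫⁻ z, ENNReal.ofReal (stdPDF n z) * f z := by
  rw [noise_eq_withDensity, lintegral_withDensity_eq_lintegral_mul _ (by fun_prop) hf]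
  rfl

/-- Change of variables under a homothety of `ℝⁿ`. -/
lemma lintegral_add_smul {n : ℕ} {c : ℝ} (hc : c ≠ 0) (a : Fin n → ℝ)
    {f : (Fin n → ℝ) → ℝ≥0∞} (hf : Measurable f) :
    ENNReal.ofReal (|c| ^ n) * ∫⁻ z, f (a + c • z) = ∫⁻ z, f z := by
  have h1 : ∫⁻ z, f (a + c • z) = ENNReal.ofReal |(c ^ n)⁻¹| * ∫⁻ z, f z := by
    have hm := Measure.map_addHaar_smul (volume : Measure (Fin n → ℝ)) hc
    have h2 : ∫⁻ z, f (a + c • z) = ∫⁻ z, f (a + z) ∂(volume.map (c • · : (Fin n → ℝ) → _)) := by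
      rw [lintegral_map (by fun_prop) (by fun_prop)]
    rw [h2, hm, lintegral_smul_measure, lintegral_add_left_eq_self]
    simp
  rw [h1, ← mul_assoc, ← ENNReal.ofReal_mul (by positivity), abs_inv, abs_pow,
    mul_inv_cancel₀ (by positivity)]
  simp

/-- A linear combination of two independent standard Gaussian vectors whose coefficients have
square sum `1` is again a standard Gaussian vector. -/
lemma map_noise_prod_noise (n : ℕ) {ρ κ : ℝ} (hρ : ρ ^ 2 + κ ^ 2 = 1) :
    ((noise n).prod (noise n)).map (fun z => ρ • z.1 + κ • z.2) = noise n := by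
  have h1 : ((gaussianReal 0 1).prod (gaussianReal 0 1)).map (fun z => ρ * z.1 + κ * z.2)
      = gaussianReal 0 1 := by
    have hc := gaussianReal_conv_gaussianReal (m₁ := 0) (m₂ := 0)
      (v₁ := NNReal.mk (ρ ^ 2) (sq_nonneg _) * 1) (v₂ := NNReal.mk (κ ^ 2) (sq_nonneg _) * 1)
    have e1 := gaussianReal_map_const_mul (μ := 0) (v := 1) ρ
    have e2 := gaussianReal_map_const_mul (μ := 0) (v := 1) κ
    simp only [mul_zero] at e1 e2
    rw [← e1, ← e2, Measure.conv, Measure.map_prod_map _ _ (by fun_prop) (by fun_prop),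
      Measure.map_map (by fun_prop) (by fun_prop)] at hc
    have e3 : NNReal.mk (ρ ^ 2) (sq_nonneg _) * 1 + NNReal.mk (κ ^ 2) (sq_nonneg _) * 1 = 1 := by
      ext; simpa using hρ
    rw [e3, add_zero] at hc
    exact hc
  have h2 := (measurePreserving_arrowProdEquivProdArrow ℝ ℝ (Fin n)
    (fun _ => gaussianReal 0 1) (fun _ => gaussianReal 0 1)).map_eq
  unfold noise
  rw [← h2, Measure.map_map (by fun_prop) (MeasurableEquiv.measurable _)]
  have h3 := Measure.pi_map_pi (μ := fun _ : Fin n => (gaussianReal 0 1).prod (gaussianReal 0 1))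
    (f := fun _ z => ρ * z.1 + κ * z.2) (hμ := fun _ => by rw [h1]; infer_instance)
    (fun _ => by fun_prop)
  simp only [h1] at h3
  exact h3

/-! ### Channel output densities and the change of measure -/

/-- The density of `X + η Z`, where `X` is uniform on the codebook `x` and `Z` is standard
Gaussian. -/
def mixPDF {n M : ℕ} (x : Fin M → Fin n → ℝ) (η : ℝ) (s : Fin n → ℝ) : ℝ :=
  (M : ℝ)⁻¹ * ∑ m, (|η| ^ n)⁻¹ * stdPDF n (η⁻¹ • (s - x m))

lemma mixPDF_pos {n M : ℕ} (hM : M ≠ 0) (x : Fin M → Fin n → ℝ) {η : ℝ} (hη : η ≠ 0)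
    (s : Fin n → ℝ) : 0 < mixPDF x η s := by
  have : Nonempty (Fin M) := ⟨⟨0, Nat.pos_of_ne_zero hM⟩⟩
  have : (0 : ℝ) < M := by positivity
  exact mul_pos (by positivity) (Finset.sum_pos
    (fun m _ => mul_pos (by positivity) (stdPDF_pos _)) Finset.univ_nonempty)

@[fun_prop]
lemma measurable_mixPDF {n M : ℕ} (x : Fin M → Fin n → ℝ) (η : ℝ) : Measurable (mixPDF x η) := by
  unfold mixPDF
  fun_prop

lemma lintegral_uniformOn_fin {M : ℕ} (f : Fin M → ℝ≥0∞) :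
    ∫⁻ m, f m ∂uniformOn (Set.univ : Set (Fin M)) = (M : ℝ≥0∞)⁻¹ * ∑ m, f m := by
  rw [uniformOn, ProbabilityTheory.cond, Measure.restrict_univ, lintegral_smul_measure, lintegral_count,
    tsum_fintype]
  simp [Measure.count_univ]

lemma lintegral_noise_add_smul {n : ℕ} (x : Fin n → ℝ) {η : ℝ} (hη : η ≠ 0)
    {f : (Fin n → ℝ) → ℝ≥0∞} (hf : Measurable f) :
    ∫⁻ w, f (x + η • w) ∂noise n
      = ∫⁻ s, ENNReal.ofReal ((|η| ^ n)⁻¹ * stdPDF n (η⁻¹ • (s - x))) * f s := by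
  have hp : (0 : ℝ) < |η| ^ n := by positivity
  rw [lintegral_noise (by fun_prop), ← lintegral_add_smul hη x
    (f := fun s => ENNReal.ofReal ((|η| ^ n)⁻¹ * stdPDF n (η⁻¹ • (s - x))) * f s) (by fun_prop),
    ← lintegral_const_mul _ (by fun_prop)]
  refine lintegral_congr fun w => ?_
  rw [add_sub_cancel_left, smul_smul, inv_mul_cancel₀ hη, one_smul, ← mul_assoc,
    ← ENNReal.ofReal_mul hp.le, mul_inv_cancel_left₀ hp.ne']

lemma lintegral_mixPDF {n M : ℕ} (x : Fin M → Fin n → ℝ) {η : ℝ} (hη : η ≠ 0)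
    {f : (Fin n → ℝ) → ℝ≥0∞} (hf : Measurable f) :
    ∫⁻ m, ∫⁻ w, f (x m + η • w) ∂noise n ∂uniformOn (Set.univ : Set (Fin M))
      = ∫⁻ s, ENNReal.ofReal (mixPDF x η s) * f s := by
  rcases Nat.eq_zero_or_pos M with rfl | hM
  · simp [mixPDF]
  rw [lintegral_uniformOn_fin]
  simp only [lintegral_noise_add_smul _ hη hf]
  rw [← lintegral_finsetSum _ fun m _ => by fun_prop, ← lintegral_const_mul _ (by fun_prop)]
  refine lintegral_congr fun s => ?_
  rw [mixPDF, ENNReal.ofReal_mul (by positivity), ENNReal.ofReal_sum_of_nonneg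
    fun m _ => mul_nonneg (by positivity) (stdPDF_pos _).le, ENNReal.ofReal_inv_of_pos (by positivity),
    ENNReal.ofReal_natCast, ← Finset.sum_mul, mul_assoc]

section Genie

variable {n M₁ M₂ : ℕ}

/-- The part of the first output that the genie signal `S₁ = X₁ + η W₁` leaves unexplained:
`Y₁ - α S₁ - b`, where `Y₁ = X₁ + ρ W₁ + h (X₂ + η W₂)`. The noises `(W₁, W₂)` are the last two
coordinates of `ω`, so that `ρ W₁ + h η W₂` is the noise of the channel. -/
def residual (x₁ : Fin M₁ → Fin n → ℝ) (x₂ : Fin M₂ → Fin n → ℝ) (h η ρ α : ℝ) (b : Fin n → ℝ)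
    (ω : Fin M₁ × Fin M₂ × (Fin n → ℝ) × (Fin n → ℝ)) : Fin n → ℝ :=
  x₁ ω.1 + ρ • ω.2.2.1 + h • (x₂ ω.2.1 + η • ω.2.2.2) - α • (x₁ ω.1 + η • ω.2.2.1) - b

/-- The ratio `q(y₁, s₁) / p(y₁, s₁ | x₁)` along the channel, where `p` is the conditional density
of `(Y₁, S₁)` given the first codeword, and `q` is the density under which `S₁` has its true law
and, given `S₁`, the vector `Y₁` is Gaussian with mean `α S₁ + b` and covariance `σ² I`. -/
def genieRatio (x₁ : Fin M₁ → Fin n → ℝ) (x₂ : Fin M₂ → Fin n → ℝ) (h η ρ α σ : ℝ)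
    (b : Fin n → ℝ) (ω : Fin M₁ × Fin M₂ × (Fin n → ℝ) × (Fin n → ℝ)) : ℝ :=
  |η| ^ n * |h| ^ n * mixPDF x₁ η (x₁ ω.1 + η • ω.2.2.1) *
      ((|σ| ^ n)⁻¹ * stdPDF n (σ⁻¹ • residual x₁ x₂ h η ρ α b ω)) /
    (stdPDF n ω.2.2.1 * mixPDF x₂ η (x₂ ω.2.1 + η • ω.2.2.2))

lemma measurable_residual (x₁ : Fin M₁ → Fin n → ℝ) (x₂ : Fin M₂ → Fin n → ℝ) (h η ρ α : ℝ)
    (b : Fin n → ℝ) : Measurable (residual x₁ x₂ h η ρ α b) := by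
  have h1 := measurable_of_finite x₁
  have h2 := measurable_of_finite x₂
  unfold residual
  fun_prop

lemma measurable_genieRatio (x₁ : Fin M₁ → Fin n → ℝ) (x₂ : Fin M₂ → Fin n → ℝ) (h η ρ α σ : ℝ)
    (b : Fin n → ℝ) : Measurable (genieRatio x₁ x₂ h η ρ α σ b) := by
  have h1 := measurable_of_finite x₁
  have h2 := measurable_of_finite x₂
  have h3 := measurable_residual x₁ x₂ h η ρ α b
  unfold genieRatio
  fun_prop

lemma genieRatio_pos (hM₁ : M₁ ≠ 0) (hM₂ : M₂ ≠ 0) (x₁ : Fin M₁ → Fin n → ℝ)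
    (x₂ : Fin M₂ → Fin n → ℝ) {h η σ : ℝ} (hh : h ≠ 0) (hη : η ≠ 0) (hσ : σ ≠ 0) (ρ α : ℝ)
    (b : Fin n → ℝ) (ω : Fin M₁ × Fin M₂ × (Fin n → ℝ) × (Fin n → ℝ)) :
    0 < genieRatio x₁ x₂ h η ρ α σ b ω := by
  have h1 := mixPDF_pos hM₁ x₁ hη (x₁ ω.1 + η • ω.2.2.1)
  have h2 := mixPDF_pos hM₂ x₂ hη (x₂ ω.2.1 + η • ω.2.2.2)
  have h3 := stdPDF_pos (σ⁻¹ • residual x₁ x₂ h η ρ α b ω)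
  have h4 := stdPDF_pos ω.2.2.1
  unfold genieRatio
  positivity

lemma lintegral_law {f : Fin M₁ × Fin M₂ × (Fin n → ℝ) × (Fin n → ℝ) → ℝ≥0∞} (hf : Measurable f) :
    ∫⁻ ω, f ω ∂law n M₁ M₂ =
      ∫⁻ m₁, ∫⁻ w, ∫⁻ m₂, ∫⁻ v, f (m₁, m₂, w, v) ∂noise n ∂uniformOn (Set.univ : Set (Fin M₂))
        ∂noise n ∂uniformOn (Set.univ : Set (Fin M₁)) := by
  rw [law, lintegral_prod _ hf.aemeasurable]
  refine lintegral_congr fun m₁ => ?_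
  have h1 : Measurable fun p : Fin M₂ × (Fin n → ℝ) × (Fin n → ℝ) => f (m₁, p) := by fun_prop
  rw [lintegral_prod _ h1.aemeasurable]
  have h2 : ∀ m₂, ∫⁻ z, f (m₁, m₂, z) ∂(noise n).prod (noise n)
      = ∫⁻ w, ∫⁻ v, f (m₁, m₂, w, v) ∂noise n ∂noise n := fun m₂ =>
    lintegral_prod _ (by fun_prop)
  simp only [h2]
  have h3 : Measurable fun q : (Fin M₂ × (Fin n → ℝ)) × (Fin n → ℝ) =>
    f (m₁, q.1.1, q.1.2, q.2) := by fun_prop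
  exact lintegral_lintegral_swap h3.lintegral_prod_right'.aemeasurable

/-- Exchanging the two users leaves the joint law of messages and noises unchanged. -/
lemma measurePreserving_swap_users : MeasurePreserving
    (fun ω : Fin M₁ × Fin M₂ × (Fin n → ℝ) × (Fin n → ℝ) => (ω.2.1, ω.1, ω.2.2.2, ω.2.2.1))
    (law n M₁ M₂) (law n M₂ M₁) := by
  refine ⟨by fun_prop, Measure.ext_of_lintegral _ fun f hf => ?_⟩
  have hswap : Measurable fun ω : Fin M₁ × Fin M₂ × (Fin n → ℝ) × (Fin n → ℝ) =>
      f (ω.2.1, ω.1, ω.2.2.2, ω.2.2.1) := by fun_prop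
  have key : ∀ {K L : ℕ} {g : Fin K × Fin L × (Fin n → ℝ) × (Fin n → ℝ) → ℝ≥0∞}, Measurable g →
      ∫⁻ ω, g ω ∂law n K L = ∫⁻ a, ∫⁻ b, g (a.1, b.1, a.2, b.2)
        ∂(uniformOn (Set.univ : Set (Fin L))).prod (noise n)
        ∂(uniformOn (Set.univ : Set (Fin K))).prod (noise n) := by
    intro K L g hg
    have hg' : Measurable fun q : (Fin K × (Fin n → ℝ)) × (Fin L × (Fin n → ℝ)) =>
      g (q.1.1, q.2.1, q.1.2, q.2.2) := by fun_prop
    rw [lintegral_law hg, lintegral_prod _ hg'.lintegral_prod_right'.aemeasurable]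
    refine lintegral_congr fun m₁ => lintegral_congr fun w => ?_
    rw [lintegral_prod _ (by fun_prop)]
  rw [lintegral_map hf (by fun_prop), key hf, key hswap, lintegral_lintegral_swap]
  apply Measurable.aemeasurable
  unfold Function.uncurry
  fun_prop

/-- Change of measure. A nonnegative test function `F m₁ y₁` that averages to at most `2` over the
messages for each fixed output still has mean at most `2` after it is weighted with the likelihood
ratio: under the product of the uniform law and `q` the output carries no information on the
message. -/
lemma lintegral_mul_genieRatio_le (hM₁ : M₁ ≠ 0) (hM₂ : M₂ ≠ 0) (x₁ : Fin M₁ → Fin n → ℝ)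
    (x₂ : Fin M₂ → Fin n → ℝ) {h η σ : ℝ} (hh : h ≠ 0) (hη : η ≠ 0) (hσ : σ ≠ 0) (ρ α : ℝ)
    (b : Fin n → ℝ) {F : Fin M₁ → (Fin n → ℝ) → ℝ≥0∞} (hF : Measurable (Function.uncurry F))
    (hF2 : ∀ y, ∫⁻ m, F m y ∂uniformOn (Set.univ : Set (Fin M₁)) ≤ 2) :
    ∫⁻ ω, F ω.1 (x₁ ω.1 + ρ • ω.2.2.1 + h • (x₂ ω.2.1 + η • ω.2.2.2)) *
      ENNReal.ofReal (genieRatio x₁ x₂ h η ρ α σ b ω) ∂law n M₁ M₂ ≤ 2 := by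
  have hx₁ := measurable_of_finite x₁
  have hx₂ := measurable_of_finite x₂
  have hR := measurable_genieRatio x₁ x₂ h η ρ α σ b
  have hF' : ∀ m, Measurable (F m) := fun m => hF.comp (measurable_const.prodMk measurable_id)
  have hηn : (0 : ℝ) < |η| ^ n := by positivity
  have hhn : (0 : ℝ) < |h| ^ n := by positivity
  set q : (Fin n → ℝ) → ℝ := fun z => (|σ| ^ n)⁻¹ * stdPDF n (σ⁻¹ • z) with hq
  have hqm : Measurable q := by fun_prop
  have hq0 : ∀ z, 0 ≤ q z := fun z => mul_nonneg (by positivity) (stdPDF_pos _).le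
  have hq1 : ∀ a, ∫⁻ z, ENNReal.ofReal (q (z - a)) = 1 := by
    intro a
    have := lintegral_noise_add_smul a hσ (f := fun _ => 1) measurable_const
    simpa [hq, ENNReal.ofReal_mul (inv_nonneg.2 (pow_nonneg (abs_nonneg σ) n))] using this.symm
  -- The mean over the second user, for fixed first codeword and noise.
  have h1 : ∀ m₁ w, ∫⁻ m₂, ∫⁻ v, F m₁ (x₁ m₁ + ρ • w + h • (x₂ m₂ + η • v)) *
        ENNReal.ofReal (genieRatio x₁ x₂ h η ρ α σ b (m₁, m₂, w, v)) ∂noise n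
        ∂uniformOn (Set.univ : Set (Fin M₂))
      = ENNReal.ofReal (|η| ^ n * mixPDF x₁ η (x₁ m₁ + η • w) / stdPDF n w) *
        ∫⁻ y, F m₁ y * ENNReal.ofReal (q (y - (α • (x₁ m₁ + η • w) + b))) := by
    intro m₁ w
    have hg1 := mixPDF_pos hM₁ x₁ hη (x₁ m₁ + η • w)
    have hw := stdPDF_pos w
    have e := lintegral_mixPDF x₂ hη (f := fun u => F m₁ (x₁ m₁ + ρ • w + h • u) *
      ENNReal.ofReal (|η| ^ n * |h| ^ n * mixPDF x₁ η (x₁ m₁ + η • w) *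
        q (x₁ m₁ + ρ • w + h • u - α • (x₁ m₁ + η • w) - b) / (stdPDF n w * mixPDF x₂ η u)))
      (by fun_prop)
    refine e.trans ?_
    rw [← lintegral_add_smul hh (x₁ m₁ + ρ • w) (f := fun y =>
      F m₁ y * ENNReal.ofReal (q (y - (α • (x₁ m₁ + η • w) + b)))) (by fun_prop),
      ← mul_assoc, ← lintegral_const_mul _ (by fun_prop)]
    refine lintegral_congr fun u => ?_
    have hu := mixPDF_pos hM₂ x₂ hη u
    rw [mul_left_comm, ← ENNReal.ofReal_mul hu.le, ← ENNReal.ofReal_mul (by positivity),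
      mul_left_comm _ (F _ _), ← ENNReal.ofReal_mul (by positivity), sub_sub]
    congr 2
    field_simp
  -- The mean over the first noise.
  have h2 : ∀ m₁, ∫⁻ w, ENNReal.ofReal (|η| ^ n * mixPDF x₁ η (x₁ m₁ + η • w) / stdPDF n w) *
        (∫⁻ y, F m₁ y * ENNReal.ofReal (q (y - (α • (x₁ m₁ + η • w) + b)))) ∂noise n
      = ∫⁻ s, ENNReal.ofReal (mixPDF x₁ η s) *
        ∫⁻ y, F m₁ y * ENNReal.ofReal (q (y - (α • s + b))) := by
    intro m₁
    have hm : Measurable fun s => ∫⁻ y, F m₁ y * ENNReal.ofReal (q (y - (α • s + b))) := by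
      have : Measurable fun z : (Fin n → ℝ) × (Fin n → ℝ) =>
        F m₁ z.2 * ENNReal.ofReal (q (z.2 - (α • z.1 + b))) := by fun_prop
      exact this.lintegral_prod_right'
    rw [lintegral_noise (by fun_prop), ← lintegral_add_smul hη (x₁ m₁) (f := fun s =>
      ENNReal.ofReal (mixPDF x₁ η s) * ∫⁻ y, F m₁ y * ENNReal.ofReal (q (y - (α • s + b))))
      (by fun_prop), ← lintegral_const_mul _ (by fun_prop)]
    refine lintegral_congr fun w => ?_
    have hw := stdPDF_pos w
    rw [← mul_assoc, ← mul_assoc, ← ENNReal.ofReal_mul hw.le, ← ENNReal.ofReal_mul hηn.le]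
    congr 2
    field_simp
  rw [lintegral_law (by fun_prop)]
  simp only [h1, h2]
  have hsy : Measurable fun p : (Fin M₁ × (Fin n → ℝ)) × (Fin n → ℝ) =>
      F p.1.1 p.2 * ENNReal.ofReal (q (p.2 - (α • p.1.2 + b))) := by
    have : Measurable fun p : (Fin M₁ × (Fin n → ℝ)) × (Fin n → ℝ) => F p.1.1 p.2 :=
      hF.comp (by fun_prop : Measurable fun p : (Fin M₁ × (Fin n → ℝ)) × (Fin n → ℝ) =>
        (p.1.1, p.2))
    fun_prop
  rw [lintegral_lintegral_swap]
  swap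
  · have := hsy.lintegral_prod_right' (ν := volume)
    apply Measurable.aemeasurable
    unfold Function.uncurry
    fun_prop
  have h3 : ∀ s, ∫⁻ m₁, ENNReal.ofReal (mixPDF x₁ η s) *
        (∫⁻ y, F m₁ y * ENNReal.ofReal (q (y - (α • s + b)))) ∂uniformOn (Set.univ : Set (Fin M₁))
      ≤ ENNReal.ofReal (mixPDF x₁ η s) * 2 := by
    intro s
    rw [lintegral_const_mul _ (measurable_of_finite _)]
    gcongr
    rw [lintegral_lintegral_swap]
    · calc ∫⁻ y, ∫⁻ m, F m y * ENNReal.ofReal (q (y - (α • s + b)))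
            ∂uniformOn (Set.univ : Set (Fin M₁))
          = ∫⁻ y, (∫⁻ m, F m y ∂uniformOn (Set.univ : Set (Fin M₁))) *
              ENNReal.ofReal (q (y - (α • s + b))) :=
            lintegral_congr fun y => lintegral_mul_const _ (measurable_of_finite _)
        _ ≤ ∫⁻ y, 2 * ENNReal.ofReal (q (y - (α • s + b))) :=
            lintegral_mono fun y => by gcongr; exact hF2 y
        _ = 2 := by rw [lintegral_const_mul _ (by fun_prop), hq1, mul_one]
    · apply Measurable.aemeasurable
      exact hF.mul (by fun_prop)
  refine (lintegral_mono h3).trans ?_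
  have : Nonempty (Fin M₁) := ⟨⟨0, Nat.pos_of_ne_zero hM₁⟩⟩
  have e := lintegral_mixPDF x₁ hη (f := fun _ => 2) measurable_const
  rw [← e]
  simp

end Genie

/-! ### Second moments -/

/-- The real random variable `f` is square integrable, has mean zero and second moment `v`. -/
structure HasCenteredMoment {Ω : Type*} [MeasurableSpace Ω] (μ : Measure Ω) (f : Ω → ℝ) (v : ℝ) :
    Prop where
  memLp : MemLp f 2 μ
  mean : ∫ ω, f ω ∂μ = 0
  moment : ∫ ω, f ω ^ 2 ∂μ = v

lemma HasCenteredMoment.add_prod {A B : Type*} [MeasurableSpace A] [MeasurableSpace B]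
    {μ : Measure A} {ν : Measure B} [IsProbabilityMeasure μ] [IsProbabilityMeasure ν]
    {f : A → ℝ} {g : B → ℝ} {u v : ℝ} (hf : HasCenteredMoment μ f u)
    (hg : HasCenteredMoment ν g v) :
    HasCenteredMoment (μ.prod ν) (fun p => f p.1 + g p.2) (u + v) := by
  have hf1 := hf.memLp.comp_fst ν
  have hg1 := hg.memLp.comp_snd μ
  have If := hf1.integrable one_le_two
  have Ig := hg1.integrable one_le_two
  have hc : Integrable (fun p : A × B => f p.1 * g p.2) (μ.prod ν) :=
    (hf.memLp.integrable one_le_two).mul_prod (hg.memLp.integrable one_le_two)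
  refine ⟨hf1.add hg1, ?_, ?_⟩
  · rw [integral_add If Ig, integral_fun_fst, integral_fun_snd, hf.mean, hg.mean]
    simp
  · have e : ∀ p : A × B, (f p.1 + g p.2) ^ 2 = f p.1 ^ 2 + g p.2 ^ 2 + 2 * (f p.1 * g p.2) :=
      fun p => by ring
    simp only [e]
    have i1 : Integrable (fun p : A × B => f p.1 ^ 2) (μ.prod ν) := hf1.integrable_sq
    have i2 : Integrable (fun p : A × B => g p.2 ^ 2) (μ.prod ν) := hg1.integrable_sq
    have i12 : Integrable (fun p : A × B => f p.1 ^ 2 + g p.2 ^ 2) (μ.prod ν) := i1.add i2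
    rw [integral_add i12 (hc.const_mul 2), integral_add i1 i2, integral_const_mul,
      integral_prod_mul, hf.mean, integral_fun_fst (fun a => f a ^ 2),
      integral_fun_snd (fun b => g b ^ 2), hf.moment, hg.moment]
    simp

lemma hasCenteredMoment_noise {n : ℕ} (c : ℝ) (k : Fin n) :
    HasCenteredMoment (noise n) (fun w => c * w k) (c ^ 2) := by
  have hm : MemLp (fun x : ℝ => x) 2 (gaussianReal 0 1) := memLp_id_gaussianReal 2
  have hp : MeasurePreserving (Function.eval k) (noise n) (gaussianReal 0 1) :=
    measurePreserving_eval (fun _ => gaussianReal 0 1) k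
  have h2 : ∫ x, x ^ 2 ∂gaussianReal 0 1 = 1 := by
    have := variance_of_integral_eq_zero (X := fun x : ℝ => x) (μ := gaussianReal 0 1)
      measurable_id.aemeasurable integral_id_gaussianReal
    rw [variance_fun_id_gaussianReal] at this
    simpa using this.symm
  refine ⟨(hm.comp_measurePreserving hp).const_mul c, ?_, ?_⟩
  · rw [integral_const_mul]
    have : ∫ w, w k ∂noise n = ∫ x, x ∂gaussianReal 0 1 :=
      integral_comp_eval (X := fun _ : Fin n => ℝ) (μ := fun _ => gaussianReal 0 1) (i := k)
        (f := fun x : ℝ => x) (by fun_prop)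
    rw [this, integral_id_gaussianReal, mul_zero]
  · simp only [mul_pow]
    rw [integral_const_mul]
    have : ∫ w, w k ^ 2 ∂noise n = ∫ x, x ^ 2 ∂gaussianReal 0 1 :=
      integral_comp_eval (X := fun _ : Fin n => ℝ) (μ := fun _ => gaussianReal 0 1) (i := k)
        (f := fun x : ℝ => x ^ 2) (by fun_prop)
    rw [this, h2, mul_one]

/-- The mean of a codebook. -/
def codeMean {n M : ℕ} (x : Fin M → Fin n → ℝ) (k : Fin n) : ℝ :=
  ∫ m, x m k ∂uniformOn (Set.univ : Set (Fin M))

/-- The variance of the `k`-th symbol of a codebook. -/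
def codeVar {n M : ℕ} (x : Fin M → Fin n → ℝ) (k : Fin n) : ℝ :=
  ∫ m, (x m k - codeMean x k) ^ 2 ∂uniformOn (Set.univ : Set (Fin M))

lemma memLp_uniformOn_fin {M : ℕ} [NeZero M] (f : Fin M → ℝ) :
    MemLp f 2 (uniformOn (Set.univ : Set (Fin M))) :=
  MemLp.of_discrete

lemma hasCenteredMoment_code {n M : ℕ} [NeZero M] (x : Fin M → Fin n → ℝ) (c : ℝ) (k : Fin n) :
    HasCenteredMoment (uniformOn (Set.univ : Set (Fin M))) (fun m => c * (x m k - codeMean x k))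
      (c ^ 2 * codeVar x k) := by
  refine ⟨memLp_uniformOn_fin _, ?_, ?_⟩
  · rw [integral_const_mul, integral_sub .of_finite .of_finite]
    simp [codeMean]
  · simp only [mul_pow]
    rw [integral_const_mul, codeVar]

lemma sum_codeVar_le {n M : ℕ} [NeZero M] {P : ℝ} (c : Code n M P) :
    ∑ k, codeVar c.enc k ≤ n * P := by
  have h1 : ∀ k, codeVar c.enc k ≤ ∫ m, c.enc m k ^ 2 ∂uniformOn (Set.univ : Set (Fin M)) := by
    intro k
    have := variance_le_expectation_sq (X := fun m => c.enc m k)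
      (μ := uniformOn (Set.univ : Set (Fin M))) (measurable_of_finite _).aestronglyMeasurable
    rwa [variance_eq_integral (measurable_of_finite _).aemeasurable] at this
  calc ∑ k, codeVar c.enc k ≤ ∑ k, ∫ m, c.enc m k ^ 2 ∂uniformOn (Set.univ : Set (Fin M)) :=
        Finset.sum_le_sum fun k _ => h1 k
    _ = ∫ m, ∑ k, c.enc m k ^ 2 ∂uniformOn (Set.univ : Set (Fin M)) :=
        (integral_finsetSum _ fun _ _ => .of_finite).symm
    _ ≤ ∫ _, n * P ∂uniformOn (Set.univ : Set (Fin M)) :=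
        integral_mono .of_finite .of_finite c.power_le
    _ = n * P := by simp

instance isProbabilityMeasure_law {n M₁ M₂ : ℕ} [NeZero M₁] [NeZero M₂] :
    IsProbabilityMeasure (law n M₁ M₂) := by
  unfold law; infer_instance

section Block

variable {n M₁ M₂ : ℕ} {P : ℝ}

/-- The mean of the first output given the genie signal, up to the term proportional to that
signal; with this shift the residual is centered, so that the codebooks may have nonzero means. -/
def genieShift (x₁ : Fin M₁ → Fin n → ℝ) (x₂ : Fin M₂ → Fin n → ℝ) (h α : ℝ) : Fin n → ℝ :=
  (1 - α) • codeMean x₁ + h • codeMean x₂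

lemma hasCenteredMoment_residual [NeZero M₁] [NeZero M₂] (x₁ : Fin M₁ → Fin n → ℝ)
    (x₂ : Fin M₂ → Fin n → ℝ) (h η ρ α : ℝ) (k : Fin n) :
    HasCenteredMoment (law n M₁ M₂)
      (fun ω => residual x₁ x₂ h η ρ α (genieShift x₁ x₂ h α) ω k)
      ((1 - α) ^ 2 * codeVar x₁ k + (h ^ 2 * codeVar x₂ k + ((ρ - α * η) ^ 2 + (h * η) ^ 2))) := by
  have H := (hasCenteredMoment_code x₁ (1 - α) k).add_prod
    ((hasCenteredMoment_code x₂ h k).add_prod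
      ((hasCenteredMoment_noise (ρ - α * η) k).add_prod (hasCenteredMoment_noise (h * η) k)))
  convert! H using 2 with ω
  simp only [residual, genieShift, Pi.add_apply, Pi.sub_apply, Pi.smul_apply, smul_eq_mul]
  ring

lemma integrable_sum_residual_sq [NeZero M₁] [NeZero M₂] (x₁ : Fin M₁ → Fin n → ℝ)
    (x₂ : Fin M₂ → Fin n → ℝ) (h η ρ α : ℝ) :
    Integrable (fun ω => ∑ k, residual x₁ x₂ h η ρ α (genieShift x₁ x₂ h α) ω k ^ 2)
      (law n M₁ M₂) :=
  integrable_finsetSum _ fun k _ =>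
    (hasCenteredMoment_residual x₁ x₂ h η ρ α k).memLp.integrable_sq

lemma integral_sum_residual_sq_le [NeZero M₁] [NeZero M₂] (c₁ : Code n M₁ P) (c₂ : Code n M₂ P)
    (h η ρ α : ℝ) :
    ∫ ω, ∑ k, residual c₁.enc c₂.enc h η ρ α (genieShift c₁.enc c₂.enc h α) ω k ^ 2
      ∂law n M₁ M₂ ≤ n * ((1 - α) ^ 2 * P + h ^ 2 * P + (ρ - α * η) ^ 2 + (h * η) ^ 2) := by
  rw [integral_finsetSum _ fun k _ =>
    (hasCenteredMoment_residual c₁.enc c₂.enc h η ρ α k).memLp.integrable_sq]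
  simp only [(hasCenteredMoment_residual c₁.enc c₂.enc h η ρ α _).moment,
    Finset.sum_add_distrib, ← Finset.mul_sum, Finset.sum_const, Finset.card_univ,
    Fintype.card_fin, nsmul_eq_mul]
  have h1 := mul_le_mul_of_nonneg_left (sum_codeVar_le c₁) (sq_nonneg (1 - α))
  have h2 := mul_le_mul_of_nonneg_left (sum_codeVar_le c₂) (sq_nonneg h)
  linarith

lemma measurePreserving_fst_noise [NeZero M₁] [NeZero M₂] :
    MeasurePreserving (fun ω : Fin M₁ × Fin M₂ × (Fin n → ℝ) × (Fin n → ℝ) => ω.2.2.1)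
      (law n M₁ M₂) (noise n) :=
  measurePreserving_fst.comp (measurePreserving_snd.comp measurePreserving_snd)

lemma integrable_sum_noise_sq (n : ℕ) : Integrable (fun w => ∑ k, w k ^ 2) (noise n) :=
  integrable_finsetSum _ fun k _ => by
    simpa using (hasCenteredMoment_noise 1 k).memLp.integrable_sq

lemma integral_sum_noise_sq (n : ℕ) : ∫ w, ∑ k, w k ^ 2 ∂noise n = n := by
  rw [integral_finsetSum _ fun k _ => by
    simpa using (hasCenteredMoment_noise 1 k).memLp.integrable_sq]
  have h1 : ∀ k : Fin n, ∫ w, w k ^ 2 ∂noise n = 1 := fun k => by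
    simpa using (hasCenteredMoment_noise 1 k).moment
  simp [h1]

/-! ### The converse for a fixed block length -/

/-- The error probability of the first user, with its noise written as `ρ W₁ + h η W₂`. -/
lemma errorProb₁_eq [NeZero M₁] [NeZero M₂] (c₁ : Code n M₁ P) (c₂ : Code n M₂ P) {h η ρ : ℝ}
    (hρ : ρ ^ 2 + h ^ 2 * η ^ 2 = 1) :
    errorProb₁ h c₁ c₂ = (law n M₁ M₂).real {ω | c₁.dec
      (c₁.enc ω.1 + ρ • ω.2.2.1 + h • (c₂.enc ω.2.1 + η • ω.2.2.2)) ≠ ω.1} := by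
  have hd := c₁.measurable_dec
  have h1 := measurable_of_finite c₁.enc
  have h2 := measurable_of_finite c₂.enc
  have hz : MeasurePreserving (fun z : (Fin n → ℝ) × (Fin n → ℝ) => ρ • z.1 + (h * η) • z.2)
      ((noise n).prod (noise n)) (noise n) :=
    ⟨by fun_prop, map_noise_prod_noise n (by rw [mul_pow, hρ])⟩
  have p1 := (MeasurePreserving.id (uniformOn (Set.univ : Set (Fin M₁)))).prod
    ((MeasurePreserving.id (uniformOn (Set.univ : Set (Fin M₂)))).prod hz)
  have p2 := (MeasurePreserving.id (uniformOn (Set.univ : Set (Fin M₁)))).prod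
    ((MeasurePreserving.id (uniformOn (Set.univ : Set (Fin M₂)))).prod
      (measurePreserving_fst (μ := noise n) (ν := noise n)))
  set A : Set (Fin M₁ × Fin M₂ × (Fin n → ℝ)) :=
    {τ | c₁.dec (c₁.enc τ.1 + h • c₂.enc τ.2.1 + τ.2.2) ≠ τ.1} with hA
  have hAm : MeasurableSet A :=
    (measurableSet_eq_fun (hd.comp (by fun_prop)) measurable_fst).compl
  have q1 := p1.measureReal_preimage hAm.nullMeasurableSet
  have q2 := p2.measureReal_preimage hAm.nullMeasurableSet
  rw [errorProb₁]
  refine Eq.trans ?_ ((q2.trans q1.symm).trans ?_)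
  · rfl
  · rw [law]
    congr 1
    ext ω
    have e : c₁.enc ω.1 + h • c₂.enc ω.2.1 + (ρ • ω.2.2.1 + (h * η) • ω.2.2.2)
        = c₁.enc ω.1 + ρ • ω.2.2.1 + h • (c₂.enc ω.2.1 + η • ω.2.2.2) := by
      rw [smul_add, smul_smul]; abel
    simp [hA, e]

lemma errorProb₂_eq_swap (c₁ : Code n M₁ P) (c₂ : Code n M₂ P) (h : ℝ) :
    errorProb₂ h c₁ c₂ = errorProb₁ h c₂ c₁ := by
  have hd := c₂.measurable_dec
  have h1 := measurable_of_finite c₁.enc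
  have h2 := measurable_of_finite c₂.enc
  have hy : Measurable (output₁ h c₂ c₁) := by
    unfold output₁
    refine measurable_pi_lambda _ fun k => ?_
    have h3 : Measurable fun m => c₁.enc m k := measurable_of_finite _
    have h4 : Measurable fun m => c₂.enc m k := measurable_of_finite _
    fun_prop
  have hAm : MeasurableSet {ω | c₂.dec (output₁ h c₂ c₁ ω) ≠ ω.1} :=
    (measurableSet_eq_fun (hd.comp hy) measurable_fst).compl
  exact (measurePreserving_swap_users (n := n) (M₁ := M₁) (M₂ := M₂)).measureReal_preimage
    hAm.nullMeasurableSet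

lemma log_genieRatio [NeZero M₁] [NeZero M₂] (x₁ : Fin M₁ → Fin n → ℝ)
    (x₂ : Fin M₂ → Fin n → ℝ) {h η σ : ℝ} (hh : h ≠ 0) (hη : η ≠ 0) (hσ : σ ≠ 0) (ρ α : ℝ)
    (b : Fin n → ℝ) (ω : Fin M₁ × Fin M₂ × (Fin n → ℝ) × (Fin n → ℝ)) :
    Real.log (genieRatio x₁ x₂ h η ρ α σ b ω) =
      n * Real.log |η| + n * Real.log |h| - n * Real.log |σ|
        + (Real.log (mixPDF x₁ η (x₁ ω.1 + η • ω.2.2.1))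
          - Real.log (mixPDF x₂ η (x₂ ω.2.1 + η • ω.2.2.2)))
        + (∑ k, ω.2.2.1 k ^ 2) / 2
        - (∑ k, residual x₁ x₂ h η ρ α b ω k ^ 2) / (2 * σ ^ 2) := by
  have h1 := mixPDF_pos (NeZero.ne M₁) x₁ hη (x₁ ω.1 + η • ω.2.2.1)
  have h2 := mixPDF_pos (NeZero.ne M₂) x₂ hη (x₂ ω.2.1 + η • ω.2.2.2)
  have h3 := stdPDF_pos (σ⁻¹ • residual x₁ x₂ h η ρ α b ω)
  have h4 := stdPDF_pos ω.2.2.1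
  have h5 : (0 : ℝ) < |η| ^ n := by positivity
  have h6 : (0 : ℝ) < |h| ^ n := by positivity
  have h7 : (0 : ℝ) < |σ| ^ n := by positivity
  rw [genieRatio, Real.log_div (by positivity) (by positivity), Real.log_mul (by positivity)
    (by positivity), Real.log_mul (by positivity) (by positivity), Real.log_mul (by positivity)
    (by positivity), Real.log_mul (by positivity) (by positivity), Real.log_mul (by positivity)
    (by positivity), Real.log_inv, Real.log_pow, Real.log_pow, Real.log_pow, log_stdPDF, log_stdPDF]
  simp only [Pi.smul_apply, smul_eq_mul, mul_pow, ← Finset.mul_sum, inv_pow]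
  field_simp
  ring

/-- The tilting factor of Fano's inequality: `M` if the message is decoded correctly, else `1`. -/
def fanoWeight (c : Code n M₁ P) (m : Fin M₁) (y : Fin n → ℝ) : ℝ := if c.dec y = m then M₁ else 1

lemma fanoWeight_pos [NeZero M₁] (c : Code n M₁ P) (m : Fin M₁) (y : Fin n → ℝ) :
    0 < fanoWeight c m y := by
  have : (0 : ℝ) < M₁ := Nat.cast_pos.2 (Nat.pos_of_ne_zero (NeZero.ne M₁))
  unfold fanoWeight
  split_ifs <;> positivity

lemma measurable_fanoWeight (c : Code n M₁ P) : Measurable (Function.uncurry (fanoWeight c)) :=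
  Measurable.ite (measurableSet_eq_fun (c.measurable_dec.comp measurable_snd) measurable_fst)
    measurable_const measurable_const

lemma lintegral_fanoWeight_le [NeZero M₁] (c : Code n M₁ P) (y : Fin n → ℝ) :
    ∫⁻ m, ENNReal.ofReal (fanoWeight c m y) ∂uniformOn (Set.univ : Set (Fin M₁)) ≤ 2 := by
  have h1 : ∀ m, ENNReal.ofReal (fanoWeight c m y) ≤ (if c.dec y = m then (M₁ : ℝ≥0∞) else 0) + 1 := by
    intro m
    unfold fanoWeight
    split_ifs <;> simp
  rw [lintegral_uniformOn_fin]
  have hM : (M₁ : ℝ≥0∞) ≠ 0 := by simpa using NeZero.ne M₁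
  calc (M₁ : ℝ≥0∞)⁻¹ * ∑ m, ENNReal.ofReal (fanoWeight c m y)
      ≤ (M₁ : ℝ≥0∞)⁻¹ * ∑ m, ((if c.dec y = m then (M₁ : ℝ≥0∞) else 0) + 1) := by
        gcongr with m; exact h1 m
    _ = 2 := by
        rw [Finset.sum_add_distrib]
        simp only [Finset.sum_ite_eq, Finset.mem_univ, if_true, Finset.sum_const, Finset.card_univ,
          Fintype.card_fin, nsmul_eq_mul, mul_one]
        rw [mul_add, ENNReal.inv_mul_cancel hM (ENNReal.natCast_ne_top _), one_add_one_eq_two]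

/-- The first user's likelihood ratio, tilted by the Fano factor. -/
def tiltedRatio (c₁ : Code n M₁ P) (c₂ : Code n M₂ P) (h η ρ α σ : ℝ) (b : Fin n → ℝ)
    (ω : Fin M₁ × Fin M₂ × (Fin n → ℝ) × (Fin n → ℝ)) : ℝ :=
  fanoWeight c₁ ω.1 (c₁.enc ω.1 + ρ • ω.2.2.1 + h • (c₂.enc ω.2.1 + η • ω.2.2.2)) *
    genieRatio c₁.enc c₂.enc h η ρ α σ b ω

lemma tiltedRatio_pos [NeZero M₁] [NeZero M₂] (c₁ : Code n M₁ P) (c₂ : Code n M₂ P) {h η σ : ℝ}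
    (hh : h ≠ 0) (hη : η ≠ 0) (hσ : σ ≠ 0) (ρ α : ℝ) (b : Fin n → ℝ)
    (ω : Fin M₁ × Fin M₂ × (Fin n → ℝ) × (Fin n → ℝ)) :
    0 < tiltedRatio c₁ c₂ h η ρ α σ b ω :=
  mul_pos (fanoWeight_pos _ _ _)
    (genieRatio_pos (NeZero.ne M₁) (NeZero.ne M₂) _ _ hh hη hσ _ _ _ _)

lemma integrable_tiltedRatio [NeZero M₁] [NeZero M₂] (c₁ : Code n M₁ P) (c₂ : Code n M₂ P)
    {h η σ : ℝ} (hh : h ≠ 0) (hη : η ≠ 0) (hσ : σ ≠ 0) (ρ α : ℝ) (b : Fin n → ℝ) :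
    Integrable (tiltedRatio c₁ c₂ h η ρ α σ b) (law n M₁ M₂) ∧
      ∫ ω, tiltedRatio c₁ c₂ h η ρ α σ b ω ∂law n M₁ M₂ ≤ 2 := by
  have h1 := measurable_of_finite c₁.enc
  have h2 := measurable_of_finite c₂.enc
  have hpos := fun ω => (tiltedRatio_pos c₁ c₂ hh hη hσ ρ α b ω).le
  have hm : Measurable (tiltedRatio c₁ c₂ h η ρ α σ b) := by
    refine Measurable.mul ?_ (measurable_genieRatio _ _ _ _ _ _ _ _)
    exact (measurable_fanoWeight c₁).comp (by fun_prop :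
      Measurable fun ω : Fin M₁ × Fin M₂ × (Fin n → ℝ) × (Fin n → ℝ) =>
        (ω.1, c₁.enc ω.1 + ρ • ω.2.2.1 + h • (c₂.enc ω.2.1 + η • ω.2.2.2)))
  have hle : ∫⁻ ω, ENNReal.ofReal (tiltedRatio c₁ c₂ h η ρ α σ b ω) ∂law n M₁ M₂ ≤ 2 := by
    have := lintegral_mul_genieRatio_le (NeZero.ne M₁) (NeZero.ne M₂) c₁.enc c₂.enc hh hη hσ ρ α b
      (F := fun m y => ENNReal.ofReal (fanoWeight c₁ m y))
      (measurable_fanoWeight c₁).ennreal_ofReal (lintegral_fanoWeight_le c₁)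
    refine le_trans (le_of_eq (lintegral_congr fun ω => ?_)) this
    rw [tiltedRatio, ENNReal.ofReal_mul (fanoWeight_pos _ _ _).le]
  refine ⟨⟨hm.aestronglyMeasurable, ?_⟩, ?_⟩
  · rw [hasFiniteIntegral_iff_ofReal (ae_of_all _ hpos)]
    exact hle.trans_lt (by simp)
  · rw [integral_eq_lintegral_of_nonneg_ae (ae_of_all _ hpos) hm.aestronglyMeasurable]
    exact ENNReal.toReal_le_of_le_ofReal (by norm_num) (by simpa using hle)

/-- The logarithm of the tilted ratio without the terms `log g₁(S₁) - log g₂(S₂)`, where `gᵢ` is the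
density of the genie signal `Sᵢ = Xᵢ + η Wᵢ`. -/
def reducedLogRatio (c₁ : Code n M₁ P) (c₂ : Code n M₂ P) (h η ρ α σ : ℝ)
    (ω : Fin M₁ × Fin M₂ × (Fin n → ℝ) × (Fin n → ℝ)) : ℝ :=
  Real.log (fanoWeight c₁ ω.1 (c₁.enc ω.1 + ρ • ω.2.2.1 + h • (c₂.enc ω.2.1 + η • ω.2.2.2)))
    + n * (Real.log |η| + Real.log |h| - Real.log |σ|)
    + (∑ k, ω.2.2.1 k ^ 2) / 2
    - (∑ k, residual c₁.enc c₂.enc h η ρ α (genieShift c₁.enc c₂.enc h α) ω k ^ 2) / (2 * σ ^ 2)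

lemma log_tiltedRatio [NeZero M₁] [NeZero M₂] (c₁ : Code n M₁ P) (c₂ : Code n M₂ P) {h η σ : ℝ}
    (hh : h ≠ 0) (hη : η ≠ 0) (hσ : σ ≠ 0) (ρ α : ℝ)
    (ω : Fin M₁ × Fin M₂ × (Fin n → ℝ) × (Fin n → ℝ)) :
    Real.log (tiltedRatio c₁ c₂ h η ρ α σ (genieShift c₁.enc c₂.enc h α) ω) =
      reducedLogRatio c₁ c₂ h η ρ α σ ω
        + (Real.log (mixPDF c₁.enc η (c₁.enc ω.1 + η • ω.2.2.1))
          - Real.log (mixPDF c₂.enc η (c₂.enc ω.2.1 + η • ω.2.2.2))) := by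
  rw [tiltedRatio, Real.log_mul (fanoWeight_pos _ _ _).ne'
    (genieRatio_pos (NeZero.ne M₁) (NeZero.ne M₂) _ _ hh hη hσ _ _ _ _).ne',
    log_genieRatio _ _ hh hη hσ, reducedLogRatio]
  ring

/-- The mean of the reduced log ratio, when `σ²` is the second moment per symbol that the residual
would have under codebooks of full power. -/
lemma integral_reducedLogRatio_ge [NeZero M₁] [NeZero M₂] (c₁ : Code n M₁ P) (c₂ : Code n M₂ P)
    {h η ρ α σ : ℝ} (hρ : ρ ^ 2 + h ^ 2 * η ^ 2 = 1) (hσ : σ ≠ 0)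
    (hσ2 : σ ^ 2 = (1 - α) ^ 2 * P + h ^ 2 * P + (ρ - α * η) ^ 2 + (h * η) ^ 2) :
    Integrable (reducedLogRatio c₁ c₂ h η ρ α σ) (law n M₁ M₂) ∧
      (1 - errorProb₁ h c₁ c₂) * Real.log M₁ + n * (Real.log |η| + Real.log |h| - Real.log |σ|)
        ≤ ∫ ω, reducedLogRatio c₁ c₂ h η ρ α σ ω ∂law n M₁ M₂ := by
  have h1 := measurable_of_finite c₁.enc
  have h2 := measurable_of_finite c₂.enc
  set A : Set (Fin M₁ × Fin M₂ × (Fin n → ℝ) × (Fin n → ℝ)) := {ω | c₁.dec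
      (c₁.enc ω.1 + ρ • ω.2.2.1 + h • (c₂.enc ω.2.1 + η • ω.2.2.2)) ≠ ω.1} with hA
  have hAm : MeasurableSet A :=
    (measurableSet_eq_fun (c₁.measurable_dec.comp (by fun_prop)) measurable_fst).compl
  have hlog : ∀ ω : Fin M₁ × Fin M₂ × (Fin n → ℝ) × (Fin n → ℝ), Real.log (fanoWeight c₁ ω.1
      (c₁.enc ω.1 + ρ • ω.2.2.1 + h • (c₂.enc ω.2.1 + η • ω.2.2.2)))
      = Aᶜ.indicator (fun _ => Real.log M₁) ω := by
    intro ω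
    by_cases hω : c₁.dec (c₁.enc ω.1 + ρ • ω.2.2.1 + h • (c₂.enc ω.2.1 + η • ω.2.2.2)) = ω.1
    · rw [Set.indicator_of_mem (by simpa [hA] using hω), fanoWeight, if_pos hω]
    · rw [Set.indicator_of_notMem (by simpa [hA] using hω), fanoWeight, if_neg hω, Real.log_one]
  have I1 : Integrable (Aᶜ.indicator fun _ => Real.log M₁) (law n M₁ M₂) :=
    (integrable_const _).indicator hAm.compl
  have e1 : ∫ ω, Aᶜ.indicator (fun _ => Real.log M₁) ω ∂law n M₁ M₂
      = (1 - errorProb₁ h c₁ c₂) * Real.log M₁ := by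
    rw [integral_indicator hAm.compl, setIntegral_const, probReal_compl_eq_one_sub hAm,
      errorProb₁_eq c₁ c₂ hρ, smul_eq_mul]
  have hp := measurePreserving_fst_noise (n := n) (M₁ := M₁) (M₂ := M₂)
  have I2 : Integrable (fun ω : Fin M₁ × Fin M₂ × (Fin n → ℝ) × (Fin n → ℝ) =>
      ∑ k, ω.2.2.1 k ^ 2) (law n M₁ M₂) := hp.integrable_comp_of_integrable (integrable_sum_noise_sq n)
  have e2 : ∫ ω, ∑ k, ω.2.2.1 k ^ 2 ∂law n M₁ M₂ = n := by
    rw [← integral_sum_noise_sq n, ← hp.map_eq, integral_map hp.measurable.aemeasurable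
      (Measurable.aestronglyMeasurable (by fun_prop))]
  have I3 := integrable_sum_residual_sq c₁.enc c₂.enc h η ρ α
  have e3 := integral_sum_residual_sq_le c₁ c₂ h η ρ α
  have hred : reducedLogRatio c₁ c₂ h η ρ α σ = fun ω => Aᶜ.indicator (fun _ => Real.log M₁) ω
    + n * (Real.log |η| + Real.log |h| - Real.log |σ|) + (∑ k, ω.2.2.1 k ^ 2) / 2
    - (∑ k, residual c₁.enc c₂.enc h η ρ α (genieShift c₁.enc c₂.enc h α) ω k ^ 2)
        / (2 * σ ^ 2) := by
    funext ω
    rw [reducedLogRatio, hlog]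
  have J1 : Integrable (fun ω => Aᶜ.indicator (fun _ => Real.log M₁) ω
    + n * (Real.log |η| + Real.log |h| - Real.log |σ|)) (law n M₁ M₂) := I1.add (integrable_const _)
  have J2 : Integrable (fun ω => Aᶜ.indicator (fun _ => Real.log M₁) ω
    + n * (Real.log |η| + Real.log |h| - Real.log |σ|) + (∑ k, ω.2.2.1 k ^ 2) / 2) (law n M₁ M₂) :=
    J1.add (I2.div_const 2)
  rw [hred]
  refine ⟨J2.sub (I3.div_const _), ?_⟩
  rw [integral_sub J2 (I3.div_const _), integral_add J1 (I2.div_const 2),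
    integral_add I1 (integrable_const _), integral_div, integral_div, e1, e2]
  have hσp : 0 < σ ^ 2 := by positivity
  have e4 : (∫ ω, ∑ k, residual c₁.enc c₂.enc h η ρ α (genieShift c₁.enc c₂.enc h α) ω k ^ 2
      ∂law n M₁ M₂) / (2 * σ ^ 2) ≤ n / 2 := by
    rw [div_le_iff₀ (by positivity), hσ2]
    linarith
  simp only [integral_const, probReal_univ, one_smul]
  linarith

/-- The converse bound for a pair of codes of block length `n`. The densities of the two genie
signals enter the two log ratios with opposite signs, because `h (X₂ + η W₂)` is both the
interference that is left at the first receiver and, up to the factor `h`, the second genie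
signal. So they cancel in the sum, and only Gaussian terms are left. -/
theorem log_card_le [NeZero M₁] [NeZero M₂] (c₁ : Code n M₁ P) (c₂ : Code n M₂ P)
    {h η ρ α V : ℝ} (hh : h ≠ 0) (hη : η ≠ 0) (hP : 0 ≤ P) (hρ : ρ ^ 2 + h ^ 2 * η ^ 2 = 1)
    (hV : V = (1 - α) ^ 2 * P + h ^ 2 * P + (ρ - α * η) ^ 2 + (h * η) ^ 2) :
    (1 - errorProb₁ h c₁ c₂) * Real.log M₁ + (1 - errorProb₂ h c₁ c₂) * Real.log M₂
      ≤ n * Real.log (V / (h ^ 2 * η ^ 2)) + 2 * Real.log 2 := by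
  have hV0 : 0 < V := by rw [hV]; positivity
  have hσ : √V ≠ 0 := (Real.sqrt_pos.2 hV0).ne'
  have hσ2 := (Real.sq_sqrt hV0.le).trans hV
  obtain ⟨I1, b1⟩ := integral_reducedLogRatio_ge c₁ c₂ (h := h) hρ hσ hσ2
  obtain ⟨I2, b2⟩ := integral_reducedLogRatio_ge c₂ c₁ (h := h) hρ hσ hσ2
  obtain ⟨J1, d1⟩ := integrable_tiltedRatio c₁ c₂ hh hη hσ ρ α (genieShift c₁.enc c₂.enc h α)
  obtain ⟨J2, d2⟩ := integrable_tiltedRatio c₂ c₁ hh hη hσ ρ α (genieShift c₂.enc c₁.enc h α)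
  rw [← errorProb₂_eq_swap] at b2
  have hs := measurePreserving_swap_users (n := n) (M₁ := M₁) (M₂ := M₂)
  have I2' := hs.integrable_comp_of_integrable I2
  have J2' : Integrable (fun ω => tiltedRatio c₂ c₁ h η ρ α √V (genieShift c₂.enc c₁.enc h α)
      (ω.2.1, ω.1, ω.2.2.2, ω.2.2.1)) (law n M₁ M₂) := hs.integrable_comp_of_integrable J2
  rw [← hs.map_eq, integral_map hs.measurable.aemeasurable
    (by rw [hs.map_eq]; exact I2.aestronglyMeasurable)] at b2
  rw [← hs.map_eq, integral_map hs.measurable.aemeasurable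
    (by rw [hs.map_eq]; exact J2.aestronglyMeasurable)] at d2
  have hlog : ∀ {t : ℝ}, 0 < t → Real.log t ≤ Real.log 2 - 1 + t / 2 := by
    intro t ht
    have := Real.log_le_sub_one_of_pos (half_pos ht)
    rw [Real.log_div ht.ne' two_ne_zero] at this
    linarith
  have hpt : ∀ ω : Fin M₁ × Fin M₂ × (Fin n → ℝ) × (Fin n → ℝ),
      reducedLogRatio c₁ c₂ h η ρ α √V ω
        + reducedLogRatio c₂ c₁ h η ρ α √V (ω.2.1, ω.1, ω.2.2.2, ω.2.2.1)
      ≤ (2 * Real.log 2 - 2) +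
        (tiltedRatio c₁ c₂ h η ρ α √V (genieShift c₁.enc c₂.enc h α) ω / 2
        + tiltedRatio c₂ c₁ h η ρ α √V (genieShift c₂.enc c₁.enc h α)
          (ω.2.1, ω.1, ω.2.2.2, ω.2.2.1) / 2) := by
    intro ω
    have t1 := hlog (tiltedRatio_pos c₁ c₂ hh hη hσ ρ α (genieShift c₁.enc c₂.enc h α) ω)
    have t2 := hlog (tiltedRatio_pos c₂ c₁ hh hη hσ ρ α (genieShift c₂.enc c₁.enc h α)
      (ω.2.1, ω.1, ω.2.2.2, ω.2.2.1))
    rw [log_tiltedRatio _ _ hh hη hσ] at t1 t2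
    linarith
  have hJ : Integrable (fun ω => tiltedRatio c₁ c₂ h η ρ α √V (genieShift c₁.enc c₂.enc h α) ω / 2
        + tiltedRatio c₂ c₁ h η ρ α √V (genieShift c₂.enc c₁.enc h α)
          (ω.2.1, ω.1, ω.2.2.2, ω.2.2.1) / 2) (law n M₁ M₂) :=
    (J1.div_const 2).add (J2'.div_const 2)
  have hint := integral_mono (I1.add I2') ((integrable_const _).add hJ) hpt
  have l1 : ∫ ω, (reducedLogRatio c₁ c₂ h η ρ α √V ω
        + reducedLogRatio c₂ c₁ h η ρ α √V (ω.2.1, ω.1, ω.2.2.2, ω.2.2.1)) ∂law n M₁ M₂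
      = _ := integral_add I1 I2'
  have l2 : ∫ ω, ((2 * Real.log 2 - 2) +
        (tiltedRatio c₁ c₂ h η ρ α √V (genieShift c₁.enc c₂.enc h α) ω / 2
        + tiltedRatio c₂ c₁ h η ρ α √V (genieShift c₂.enc c₁.enc h α)
          (ω.2.1, ω.1, ω.2.2.2, ω.2.2.1) / 2)) ∂law n M₁ M₂ ≤ 2 * Real.log 2 := by
    rw [integral_add (integrable_const _) hJ, integral_add (J1.div_const 2) (J2'.div_const 2),
      integral_div, integral_div, integral_const, probReal_univ, one_smul]
    linarith
  have hV2 : Real.log (V / (h ^ 2 * η ^ 2))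
      = 2 * Real.log |√V| - 2 * Real.log |h| - 2 * Real.log |η| := by
    rw [Real.log_div hV0.ne' (by positivity), Real.log_mul (by positivity) (by positivity),
      Real.log_pow, Real.log_pow, Real.log_abs, Real.log_abs, Real.log_abs,
      Real.log_sqrt hV0.le]
    push_cast
    ring
  rw [hV2]
  have hint' := (l1.symm.trans_le hint).trans l2
  linarith

end Block

/-! ### From block codes to the sum capacity -/

lemma numMessages_ne_zero (n : ℕ) {R : ℝ} (hR : 0 ≤ R) : numMessages n R ≠ 0 := by
  have : (1 : ℝ) ≤ 2 ^ ((n : ℝ) * R) := Real.one_le_rpow one_le_two (by positivity)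
  exact (Nat.floor_pos.2 this).ne'

lemma log_numMessages_ge (n : ℕ) {R : ℝ} (hR : 0 ≤ R) :
    n * (R * Real.log 2) - Real.log 2 ≤ Real.log (numMessages n R) := by
  have h1 : (1 : ℝ) ≤ 2 ^ ((n : ℝ) * R) := Real.one_le_rpow one_le_two (by positivity)
  have h2 : (2 : ℝ) ^ ((n : ℝ) * R) / 2 ≤ numMessages n R := by
    have h3 := Nat.lt_floor_add_one ((2 : ℝ) ^ ((n : ℝ) * R))
    have h4 : (1 : ℝ) ≤ numMessages n R :=
      Nat.one_le_cast.2 (Nat.pos_of_ne_zero (numMessages_ne_zero n hR))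
    unfold numMessages at h4 ⊢
    linarith
  have h5 := Real.log_le_log (by positivity) h2
  rw [Real.log_div (by positivity) two_ne_zero, Real.log_rpow two_pos] at h5
  linarith

/-- The genie-aided bound for every admissible pair `(η, ρ)` and every coefficient `α` with which the
output is estimated from the genie signal; `V` is the mean square error per symbol under full
power. -/
theorem sumCapacity_le {h P η ρ α V : ℝ} (hh : h ≠ 0) (hη : η ≠ 0) (hP : 0 ≤ P)
    (hρ : ρ ^ 2 + h ^ 2 * η ^ 2 = 1)
    (hV : V = (1 - α) ^ 2 * P + h ^ 2 * P + (ρ - α * η) ^ 2 + (h * η) ^ 2) :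
    sumCapacity h h P P ≤ ((Real.logb 2 (V / (h ^ 2 * η ^ 2)) : ℝ) : EReal) := by
  refine iSup_le fun R₁ => iSup_le fun R₂ => iSup_le fun hR => ?_
  obtain ⟨hR₁, hR₂, c₁, c₂, t1, t2⟩ := hR
  have hl2 : 0 < Real.log 2 := Real.log_pos one_lt_two
  rw [EReal.coe_le_coe_iff, Real.logb, le_div_iff₀ hl2]
  set L := Real.log (V / (h ^ 2 * η ^ 2))
  set ε₁ : ℕ → ℝ := fun n => errorProb₁ h (c₁ n) (c₂ n)
  set ε₂ : ℕ → ℝ := fun n => errorProb₂ h (c₁ n) (c₂ n)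
  have hinv : Tendsto (fun n : ℕ => Real.log 2 / n) atTop (nhds 0) :=
    tendsto_const_div_atTop_nhds_zero_nat _
  have hleft : Tendsto (fun n : ℕ => (1 - ε₁ n) * (R₁ * Real.log 2 - Real.log 2 / n)
      + (1 - ε₂ n) * (R₂ * Real.log 2 - Real.log 2 / n)) atTop
      (nhds ((1 - 0) * (R₁ * Real.log 2 - 0) + (1 - 0) * (R₂ * Real.log 2 - 0))) :=
    ((t1.const_sub 1).mul (hinv.const_sub _)).add ((t2.const_sub 1).mul (hinv.const_sub _))
  have hright : Tendsto (fun n : ℕ => L + 2 * (Real.log 2 / n)) atTop (nhds (L + 2 * 0)) :=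
    (hinv.const_mul 2).const_add L
  have hle := le_of_tendsto_of_tendsto hleft hright ?_
  · linarith
  filter_upwards [eventually_gt_atTop 0] with n hn
  have : NeZero (numMessages n R₁) := ⟨numMessages_ne_zero n hR₁⟩
  have : NeZero (numMessages n R₂) := ⟨numMessages_ne_zero n hR₂⟩
  have hb := log_card_le (c₁ n) (c₂ n) hh hη hP hρ hV
  have hn' : (0 : ℝ) < n := Nat.cast_pos.2 hn
  have p1 : 0 ≤ 1 - ε₁ n := sub_nonneg.2 measureReal_le_one
  have p2 : 0 ≤ 1 - ε₂ n := sub_nonneg.2 measureReal_le_one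
  have q1 := mul_le_mul_of_nonneg_left (log_numMessages_ge n hR₁) p1
  have q2 := mul_le_mul_of_nonneg_left (log_numMessages_ge n hR₂) p2
  have e : ∀ R : ℝ, R * Real.log 2 - Real.log 2 / n = (n * (R * Real.log 2) - Real.log 2) / n := by
    intro R; field_simp
  have e' : L + 2 * (Real.log 2 / n) = (n * L + 2 * Real.log 2) / n := by field_simp
  rw [e, e, e', ← mul_div_assoc, ← mul_div_assoc, ← add_div]
  exact div_le_div_of_nonneg_right (by linarith) hn'.le

/-! ### Tangents to the useful-genie curve -/

lemma mem_usefulGenieCurve_iff {h P x y : ℝ} :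
    (x, y) ∈ usefulGenieCurve h P ↔
      0 < x ^ 2 + y ^ 2 ∧ h ^ 2 * (x ^ 2 + y ^ 2) ^ 2 + h ^ 2 * P * x ^ 2 - y ^ 2 = 0 := by
  constructor
  · rintro ⟨η, θ, hη, he, hq⟩
    obtain ⟨rfl, rfl⟩ := Prod.mk.inj hq
    have hr : (η * Real.cos θ) ^ 2 + (η * Real.sin θ) ^ 2 = η ^ 2 := by
      linear_combination η ^ 2 * Real.sin_sq_add_cos_sq θ
    rw [hr]
    refine ⟨by positivity, ?_⟩
    linear_combination η ^ 2 * he - η ^ 2 * Real.sin_sq_add_cos_sq θ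
  · rintro ⟨hr, he⟩
    set z : ℂ := ⟨x, y⟩
    have hx : ‖z‖ * Real.cos z.arg = x := Complex.norm_mul_cos_arg z
    have hy : ‖z‖ * Real.sin z.arg = y := Complex.norm_mul_sin_arg z
    have hz2 : ‖z‖ ^ 2 = x ^ 2 + y ^ 2 := by
      rw [Complex.sq_norm, Complex.normSq_mk]; ring
    have hz : 0 < ‖z‖ := by
      rcases (norm_nonneg z).eq_or_lt with h0 | h0
      · rw [← h0] at hz2; linarith
      · exact h0
    refine ⟨‖z‖, z.arg, hz, ?_, by rw [hx, hy]⟩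
    have hz2' : ‖z‖ ^ 2 ≠ 0 := by positivity
    apply mul_left_cancel₀ hz2'
    have e1 : ‖z‖ ^ 2 * Real.cos z.arg ^ 2 = x ^ 2 := by rw [← mul_pow, hx]
    linear_combination he + (1 + h ^ 2 * P) * e1 + (h ^ 2 * (‖z‖ ^ 2 + (x ^ 2 + y ^ 2)) - 1) * hz2

/-- The gradient of the defining polynomial annihilates every tangent direction. -/
lemma gradient_of_mem_tangentConeAt {h P x y : ℝ} {v : ℝ × ℝ}
    (hv : v ∈ tangentConeAt ℝ (usefulGenieCurve h P) (x, y)) (hq : (x, y) ∈ usefulGenieCurve h P) :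
    (4 * h ^ 2 * (x ^ 2 + y ^ 2) + 2 * (h ^ 2 * P)) * x * v.1
      + (4 * h ^ 2 * (x ^ 2 + y ^ 2) - 2) * y * v.2 = 0 := by
  set f : ℝ × ℝ → ℝ := fun p =>
    h ^ 2 * (p.1 ^ 2 + p.2 ^ 2) ^ 2 + h ^ 2 * P * p.1 ^ 2 - p.2 ^ 2 with hf
  have h1 : HasFDerivAt (fun p : ℝ × ℝ => p.1) (ContinuousLinearMap.fst ℝ ℝ ℝ) (x, y) :=
    hasFDerivAt_fst
  have h2 : HasFDerivAt (fun p : ℝ × ℝ => p.2) (ContinuousLinearMap.snd ℝ ℝ ℝ) (x, y) :=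
    hasFDerivAt_snd
  have hd := (((((h1.pow 2).add (h2.pow 2)).pow 2).const_mul (h ^ 2)).add
    ((h1.pow 2).const_mul (h ^ 2 * P))).sub (h2.pow 2)
  have h0 : HasFDerivWithinAt f (0 : ℝ × ℝ →L[ℝ] ℝ) (usefulGenieCurve h P) (x, y) :=
    (hasFDerivWithinAt_const (0 : ℝ) (x, y) _).congr
      (fun p hp => (mem_usefulGenieCurve_iff.1 hp).2) (mem_usefulGenieCurve_iff.1 hq).2
  have := (hd.hasFDerivWithinAt (s := usefulGenieCurve h P)).unique_on h0 hv
  simp at this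
  linear_combination this

/-- The velocity of a path in a set is a tangent direction of the set. -/
lemma mem_tangentConeAt_of_hasDerivAt {E : Type*} [NormedAddCommGroup E] [NormedSpace ℝ E]
    {s : Set E} {ψ : ℝ → E} {v : E} (hψ : HasDerivAt ψ v 0) (hs : ∀ᶠ τ in nhds 0, ψ τ ∈ s) :
    v ∈ tangentConeAt ℝ s (ψ 0) := by
  refine mem_tangentConeAt_of_seq (nhdsWithin (0 : ℝ) {0}ᶜ) (fun τ => τ⁻¹) (fun τ => ψ τ - ψ 0)
    ?_ ?_ ?_
  · have := (hψ.continuousAt.tendsto.sub_const (ψ 0)).mono_left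
      (nhdsWithin_le_nhds (s := ({0}ᶜ : Set ℝ)))
    rwa [sub_self] at this
  · filter_upwards [hs.filter_mono nhdsWithin_le_nhds] with τ hτ
    simpa using hτ
  · have := hasDerivAt_iff_tendsto_slope.1 hψ
    refine this.congr fun τ => ?_
    simp [slope]

/-- Every direction annihilated by the gradient of the defining polynomial is the velocity of a
path that runs along the curve in polar coordinates. -/
lemma mem_tangentConeAt_of_gradient {h P x y : ℝ} (hh : h ≠ 0) {v : ℝ × ℝ}
    (hq : (x, y) ∈ usefulGenieCurve h P)
    (hv : (4 * h ^ 2 * (x ^ 2 + y ^ 2) + 2 * (h ^ 2 * P)) * x * v.1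
      + (4 * h ^ 2 * (x ^ 2 + y ^ 2) - 2) * y * v.2 = 0) :
    v ∈ tangentConeAt ℝ (usefulGenieCurve h P) (x, y) := by
  obtain ⟨-, hF⟩ := mem_usefulGenieCurve_iff.1 hq
  obtain ⟨η, θ, hη, he, hq'⟩ := hq
  obtain ⟨hx, hy⟩ := Prod.mk.inj hq'
  have hr : x ^ 2 + y ^ 2 = η ^ 2 := by
    rw [hx, hy]; linear_combination η ^ 2 * Real.sin_sq_add_cos_sq θ
  have hha : 0 < |h| := abs_pos.2 hh
  have hrad : 1 - (1 + h ^ 2 * P) * Real.cos θ ^ 2 = (|h| * η) ^ 2 := by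
    rw [mul_pow, sq_abs]; linarith
  have hsq : √(1 - (1 + h ^ 2 * P) * Real.cos θ ^ 2) = |h| * η := by
    rw [hrad, Real.sqrt_sq (by positivity)]
  -- The angular speed is read off from the component of `v` that is orthogonal to the radius.
  set c : ℝ := (x * v.2 - y * v.1) / η ^ 2 with hc
  set g : ℝ → ℝ := fun τ => √(1 - (1 + h ^ 2 * P) * Real.cos (θ + c * τ) ^ 2) / |h| with hg
  have hlin : HasDerivAt (fun τ : ℝ => θ + c * τ) c 0 := by
    simpa using ((hasDerivAt_id (0 : ℝ)).const_mul c).const_add θ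
  have hcos := hlin.cos
  have hsin := hlin.sin
  simp only [mul_zero, add_zero] at hcos hsin
  have hin := ((hcos.pow 2).const_mul (1 + h ^ 2 * P)).const_sub 1
  have hg' := (hin.sqrt (by
    simp only [Pi.pow_apply, mul_zero, add_zero, hrad]; positivity)).div_const |h|
  simp only [Pi.pow_apply, mul_zero, add_zero, hsq] at hg'
  have hg0 : g 0 = η := by
    simp only [hg, mul_zero, add_zero, hsq]
    field_simp
  have hgc : ContinuousAt g 0 := hg'.continuousAt
  have hcv : c = (Real.cos θ * v.2 - Real.sin θ * v.1) / η := by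
    rw [hc, hx, hy]; field_simp
  have hcs := Real.sin_sq_add_cos_sq θ
  have hgrad : (1 + h ^ 2 * P) * Real.cos θ * Real.sin θ *
      (Real.cos θ * v.2 - Real.sin θ * v.1)
      = h ^ 2 * η ^ 2 * (Real.cos θ * v.1 + Real.sin θ * v.2) := by
    rw [hr, hx, hy] at hv
    apply mul_left_cancel₀ hη.ne'
    linear_combination (-1 / 2) * hv + η * (Real.cos θ * v.1 + Real.sin θ * v.2) * he
      - η * (1 + h ^ 2 * P) * Real.cos θ * v.1 * hcs
  have hgd : HasDerivAt g (Real.cos θ * v.1 + Real.sin θ * v.2) 0 := by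
    refine hg'.congr_deriv ?_
    have e1 : -((1 + h ^ 2 * P) * ((2 : ℕ) * Real.cos θ ^ (2 - 1) * (-Real.sin θ * c)))
        / (2 * (|h| * η)) / |h| = (1 + h ^ 2 * P) * Real.cos θ * Real.sin θ *
          (Real.cos θ * v.2 - Real.sin θ * v.1) / (|h| ^ 2 * η ^ 2) := by
      rw [hcv]; push_cast; field_simp
    rw [e1, hgrad, sq_abs]
    field_simp
  have hψ : HasDerivAt (fun τ => (g τ * Real.cos (θ + c * τ), g τ * Real.sin (θ + c * τ))) v 0 := by
    refine ((hgd.mul hcos).prodMk (hgd.mul hsin)).congr_deriv ?_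
    simp only [mul_zero, add_zero, hg0, hcv]
    ext
    · field_simp
      linear_combination v.1 * hcs
    · field_simp
      linear_combination v.2 * hcs
  have hmem : ∀ᶠ τ in nhds (0 : ℝ),
      (g τ * Real.cos (θ + c * τ), g τ * Real.sin (θ + c * τ)) ∈ usefulGenieCurve h P := by
    filter_upwards [hgc.eventually (lt_mem_nhds (hg0.symm ▸ hη))] with τ hτ
    refine ⟨g τ, θ + c * τ, hτ, ?_, rfl⟩
    have h1 : 0 ≤ 1 - (1 + h ^ 2 * P) * Real.cos (θ + c * τ) ^ 2 := by
      by_contra! hneg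
      have : g τ = 0 := by simp only [hg, Real.sqrt_eq_zero_of_nonpos hneg.le, zero_div]
      linarith
    have h2 : h ^ 2 * g τ ^ 2 = 1 - (1 + h ^ 2 * P) * Real.cos (θ + c * τ) ^ 2 := by
      simp only [hg, div_pow, Real.sq_sqrt h1, sq_abs]
      field_simp
    linarith
  have key := mem_tangentConeAt_of_hasDerivAt (s := usefulGenieCurve h P) hψ hmem
  have hpt : ((g 0 * Real.cos (θ + c * 0), g 0 * Real.sin (θ + c * 0)) : ℝ × ℝ) = (x, y) := by
    rw [hg0, hx, hy]; simp
  rwa [hpt] at key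

/-- The points where a line through `(√(1 + h²P), 0)` touches the useful-genie curve. -/
def touchingPoints (h P : ℝ) : Set (ℝ × ℝ) :=
  {q ∈ usefulGenieCurve h P | h ^ 2 * (q.1 ^ 2 + q.2 ^ 2) ^ 2
    = √(1 + h ^ 2 * P) * q.1 * (2 * h ^ 2 * (q.1 ^ 2 + q.2 ^ 2) + h ^ 2 * P)}

lemma snd_ne_zero_of_mem_curve {h P x y : ℝ} (hh : h ≠ 0) (hP : 0 ≤ P)
    (hq : (x, y) ∈ usefulGenieCurve h P) : y ≠ 0 := by
  obtain ⟨hr, hF⟩ := mem_usefulGenieCurve_iff.1 hq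
  rintro rfl
  have : 0 < h ^ 2 * (x ^ 2 + 0 ^ 2) ^ 2 + h ^ 2 * P * x ^ 2 - 0 ^ 2 := by
    have h1 : 0 < h ^ 2 * (x ^ 2 + 0 ^ 2) ^ 2 := by positivity
    have h2 : 0 ≤ h ^ 2 * P * x ^ 2 := by positivity
    linarith
  exact this.ne' hF

lemma ne_zero_of_half_lt {h P : ℝ} (hh : 1 / 2 < |h + h ^ 3 * P|) : h ≠ 0 := by
  rintro rfl
  norm_num at hh

/-- The hypothesis `|h + h³P| > 1/2` says that the vertical line through `(√(1 + h²P), 0)` misses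
the curve. -/
lemma fst_ne_sqrt_of_mem_curve {h P x y : ℝ} (hP : 0 ≤ P) (hh : 1 / 2 < |h + h ^ 3 * P|)
    (hq : (x, y) ∈ usefulGenieCurve h P) : x ≠ √(1 + h ^ 2 * P) := by
  obtain ⟨-, hF⟩ := mem_usefulGenieCurve_iff.1 hq
  intro hx
  have hx2 : x ^ 2 = 1 + h ^ 2 * P := by rw [hx, Real.sq_sqrt (by positivity)]
  have hh2 : (1 / 2) ^ 2 < (h + h ^ 3 * P) ^ 2 := by
    rw [← sq_abs (h + h ^ 3 * P)]
    exact pow_lt_pow_left₀ hh (by norm_num) two_ne_zero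
  rw [hx2] at hF
  have hsq : (2 * h ^ 2 * y ^ 2 + 2 * h ^ 2 * (1 + h ^ 2 * P) - 1) ^ 2
      = 1 - 4 * (h + h ^ 3 * P) ^ 2 := by
    linear_combination 4 * h ^ 2 * hF
  nlinarith [sq_nonneg (2 * h ^ 2 * y ^ 2 + 2 * h ^ 2 * (1 + h ^ 2 * P) - 1)]

lemma isTangentSlope_iff {h P μ : ℝ} (hP : 0 ≤ P) (hh : 1 / 2 < |h + h ^ 3 * P|) :
    IsTangentSlope h P μ ↔ ∃ q ∈ touchingPoints h P, q.2 = μ * (q.1 - √(1 + h ^ 2 * P)) := by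
  constructor
  · rintro ⟨⟨x, y⟩, hq, hl, hv⟩
    refine ⟨(x, y), ⟨hq, ?_⟩, hl⟩
    have hg := gradient_of_mem_tangentConeAt hv hq
    obtain ⟨-, hF⟩ := mem_usefulGenieCurve_iff.1 hq
    simp only at hl hg ⊢
    linear_combination (-1) * hF + (1 / 2) * (x - √(1 + h ^ 2 * P)) * hg
      + (2 * h ^ 2 * (x ^ 2 + y ^ 2) - 1) * y * hl
  · rintro ⟨⟨x, y⟩, ⟨hq, ht⟩, hl⟩
    refine ⟨(x, y), hq, hl, mem_tangentConeAt_of_gradient (ne_zero_of_half_lt hh) hq ?_⟩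
    obtain ⟨-, hF⟩ := mem_usefulGenieCurve_iff.1 hq
    apply mul_left_cancel₀ (sub_ne_zero.2 (fst_ne_sqrt_of_mem_curve hP hh hq))
    simp only at hl ht ⊢
    linear_combination 2 * ht + 2 * hF - 2 * (2 * h ^ 2 * (x ^ 2 + y ^ 2) - 1) * y * hl

/-- In terms of `A = h²(x² + y²)` the touching condition is a cubic equation. -/
lemma cubic_of_mem_touchingPoints {h P x y : ℝ} (hP : 0 ≤ P) (hh : h ≠ 0)
    (hq : (x, y) ∈ touchingPoints h P) {A : ℝ} (hA : A = h ^ 2 * (x ^ 2 + y ^ 2)) :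
    0 < A ∧ A ≤ 1 ∧ A ^ 3 = h ^ 2 * (1 - A) * (2 * A + h ^ 2 * P) ^ 2 := by
  obtain ⟨hq, ht⟩ := hq
  obtain ⟨hr, hF⟩ := mem_usefulGenieCurve_iff.1 hq
  simp only at ht
  have hs : √(1 + h ^ 2 * P) ^ 2 = 1 + h ^ 2 * P := Real.sq_sqrt (by positivity)
  have hx : (1 + h ^ 2 * P) * x ^ 2 = (x ^ 2 + y ^ 2) * (1 - A) := by
    rw [hA]; linear_combination hF
  refine ⟨by rw [hA]; positivity, ?_, ?_⟩
  · have h1 : 0 ≤ (x ^ 2 + y ^ 2) * (1 - A) := by rw [← hx]; positivity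
    linarith [nonneg_of_mul_nonneg_right h1 hr]
  · have h2 : (A * (x ^ 2 + y ^ 2)) ^ 2
        = (x ^ 2 + y ^ 2) * ((1 - A) * (2 * A + h ^ 2 * P) ^ 2) := by
      have e : A * (x ^ 2 + y ^ 2) = √(1 + h ^ 2 * P) * x * (2 * A + h ^ 2 * P) := by
        rw [hA]; linear_combination ht
      rw [e]
      linear_combination (2 * A + h ^ 2 * P) ^ 2 * hx + x ^ 2 * (2 * A + h ^ 2 * P) ^ 2 * hs
    apply mul_left_cancel₀ hr.ne'
    linear_combination h ^ 2 * h2 + A ^ 2 * (x ^ 2 + y ^ 2) * hA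

lemma cubic_unique {h k A B : ℝ} (hh : h ≠ 0) (hk : 0 ≤ k) (hA : 0 < A) (hAB : A < B)
    (hA3 : A ^ 3 = h ^ 2 * (1 - A) * (2 * A + k) ^ 2)
    (hB3 : B ^ 3 = h ^ 2 * (1 - B) * (2 * B + k) ^ 2) : False := by
  have hB : 0 < B := hA.trans hAB
  have h1 : A * (2 * B + k) ≤ B * (2 * A + k) := by nlinarith
  have h2 : (A * (2 * B + k)) ^ 2 ≤ (B * (2 * A + k)) ^ 2 :=
    pow_le_pow_left₀ (by positivity) h1 2
  have h3 : A * (A * (2 * B + k)) ^ 2 < B * (B * (2 * A + k)) ^ 2 :=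
    (mul_le_mul_of_nonneg_left h2 hA.le).trans_lt (mul_lt_mul_of_pos_right hAB (by positivity))
  have h4 : 0 < h ^ 2 * (2 * A + k) ^ 2 * (2 * B + k) ^ 2 * (B - A) :=
    mul_pos (by positivity) (sub_pos.2 hAB)
  have h5 : A * (A * (2 * B + k)) ^ 2 - B * (B * (2 * A + k)) ^ 2
      = h ^ 2 * (2 * A + k) ^ 2 * (2 * B + k) ^ 2 * (B - A) := by
    linear_combination (2 * B + k) ^ 2 * hA3 - (2 * A + k) ^ 2 * hB3
  linarith

lemma cubic_exists {h k : ℝ} (hh : h ≠ 0) (hk : 0 ≤ k) :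
    ∃ A : ℝ, 0 < A ∧ A ≤ 1 ∧ A ^ 3 = h ^ 2 * (1 - A) * (2 * A + k) ^ 2 := by
  -- The left end point is the root for `k = 0`; it keeps the double root `A = 0` away.
  set a : ℝ := 4 * h ^ 2 / (1 + 4 * h ^ 2) with ha
  have ha0 : 0 < a := by positivity
  have ha1 : a ≤ 1 := by rw [ha, div_le_one (by positivity)]; linarith
  have hc : ContinuousOn (fun A : ℝ => A ^ 3 - h ^ 2 * (1 - A) * (2 * A + k) ^ 2)
    (Set.Icc a 1) := by fun_prop
  have hl : a ^ 3 - h ^ 2 * (1 - a) * (2 * a + k) ^ 2 ≤ 0 := by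
    have e : a = 4 * h ^ 2 * (1 - a) := by rw [ha]; field_simp; ring
    have h1 : (2 * a) ^ 2 ≤ (2 * a + k) ^ 2 :=
      pow_le_pow_left₀ (by positivity) (by linarith) 2
    have h2 : 0 ≤ h ^ 2 * (1 - a) := mul_nonneg (by positivity) (by linarith)
    have h3 : a ^ 3 = h ^ 2 * (1 - a) * (2 * a) ^ 2 := by linear_combination a ^ 2 * e
    rw [h3]
    linarith [mul_le_mul_of_nonneg_left h1 h2]
  obtain ⟨A, ⟨hA1, hA2⟩, hA⟩ := intermediate_value_Icc ha1 hc ⟨hl, by norm_num⟩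
  exact ⟨A, ha0.trans_le hA1, hA2, sub_eq_zero.1 hA⟩

/-- Any two touching points agree or are mirror images in the horizontal axis. -/
lemma touchingPoints_unique {h P x y x' y' : ℝ} (hP : 0 ≤ P) (hh : h ≠ 0)
    (hq : (x, y) ∈ touchingPoints h P) (hq' : (x', y') ∈ touchingPoints h P) :
    x = x' ∧ y ^ 2 = y' ^ 2 := by
  have hk : 0 ≤ h ^ 2 * P := by positivity
  have hh2 : 0 < h ^ 2 := by positivity
  obtain ⟨hA, -, hA3⟩ := cubic_of_mem_touchingPoints hP hh hq rfl
  obtain ⟨hB, -, hB3⟩ := cubic_of_mem_touchingPoints hP hh hq' rfl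
  have hAB : h ^ 2 * (x ^ 2 + y ^ 2) = h ^ 2 * (x' ^ 2 + y' ^ 2) := by
    rcases lt_trichotomy (h ^ 2 * (x ^ 2 + y ^ 2)) (h ^ 2 * (x' ^ 2 + y' ^ 2)) with hlt | he | hlt
    · exact (cubic_unique hh hk hA hlt hA3 hB3).elim
    · exact he
    · exact (cubic_unique hh hk hB hlt hB3 hA3).elim
  have hr := mul_left_cancel₀ hh2.ne' hAB
  have ht := hq.2
  have ht' := hq'.2
  simp only at ht ht'
  rw [← hr] at ht'
  have hs : 0 < √(1 + h ^ 2 * P) := Real.sqrt_pos.2 (by positivity)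
  have hne : √(1 + h ^ 2 * P) * (2 * h ^ 2 * (x ^ 2 + y ^ 2) + h ^ 2 * P) ≠ 0 := by
    have : 0 < 2 * h ^ 2 * (x ^ 2 + y ^ 2) + h ^ 2 * P := by linarith
    positivity
  have hxx : x = x' := by
    apply mul_left_cancel₀ hne
    linear_combination ht' - ht
  refine ⟨hxx, ?_⟩
  rw [hxx] at hr
  linarith

lemma touchingPoints_nonempty {h P : ℝ} (hP : 0 ≤ P) (hh : h ≠ 0) :
    (touchingPoints h P).Nonempty := by
  have hk : 0 ≤ h ^ 2 * P := by positivity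
  obtain ⟨A, hA0, hA1, hA⟩ := cubic_exists hh hk
  have hs2 : √(1 + h ^ 2 * P) ^ 2 = 1 + h ^ 2 * P := Real.sq_sqrt (by positivity)
  set s := √(1 + h ^ 2 * P) with hs
  have hs0 : 0 < s := Real.sqrt_pos.2 (by positivity)
  have hd : 0 < 2 * A + h ^ 2 * P := by positivity
  set x := A ^ 2 / (h ^ 2 * s * (2 * A + h ^ 2 * P)) with hx
  set y := √(A * (A + h ^ 2 * P)) / (|h| * s) with hy
  have hx2 : x ^ 2 = A * (1 - A) / (h ^ 2 * s ^ 2) := by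
    rw [hx, div_pow, div_eq_div_iff (by positivity) (by positivity)]
    linear_combination A * h ^ 2 * s ^ 2 * hA
  have hy2 : y ^ 2 = A * (A + h ^ 2 * P) / (h ^ 2 * s ^ 2) := by
    rw [hy, div_pow, Real.sq_sqrt (by positivity), mul_pow, sq_abs]
  have hr : x ^ 2 + y ^ 2 = A / h ^ 2 := by
    rw [hx2, hy2, hs2]
    have : 1 + h ^ 2 * P ≠ 0 := by positivity
    field_simp
    ring
  refine ⟨(x, y), mem_usefulGenieCurve_iff.2 ⟨by rw [hr]; positivity, ?_⟩, ?_⟩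
  · rw [hr, hx2, hy2, hs2]
    have : 1 + h ^ 2 * P ≠ 0 := by positivity
    field_simp
    ring
  · simp only
    rw [hr, hx]
    field_simp
    exact hs

/-- The bound of `sumCapacity_le` at a point of the curve, expressed through the slope of the line
that joins the point to `(√(1 + h²P), 0)`. -/
lemma sumCapacity_le_of_mem_curve {h P μ x y : ℝ} (hP : 0 ≤ P) (hh : h ≠ 0)
    (hq : (x, y) ∈ usefulGenieCurve h P) (hl : y = μ * (x - √(1 + h ^ 2 * P))) :
    sumCapacity h h P P ≤
      ((Real.logb 2 (1 + P / (1 + h ^ 2 * P) * (1 + 1 / μ ^ 2)) : ℝ) : EReal) := by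
  have hy0 := snd_ne_zero_of_mem_curve hh hP hq
  have hs2 : √(1 + h ^ 2 * P) ^ 2 = 1 + h ^ 2 * P := Real.sq_sqrt (by positivity)
  have hs0 : 0 < √(1 + h ^ 2 * P) := Real.sqrt_pos.2 (by positivity)
  obtain ⟨η, θ, hη, he, hq'⟩ := hq
  obtain ⟨hx, hy⟩ := Prod.mk.inj hq'
  set s := √(1 + h ^ 2 * P) with hs
  have hμ : μ ≠ 0 := by rintro rfl; exact hy0 (by rw [hl, zero_mul])
  have hr : x ^ 2 + y ^ 2 = η ^ 2 := by
    rw [hx, hy]; linear_combination η ^ 2 * Real.sin_sq_add_cos_sq θ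
  set ρ := s * Real.cos θ with hρ
  have hρ1 : ρ ^ 2 + h ^ 2 * η ^ 2 = 1 := by
    rw [hρ, mul_pow, hs2]; linarith
  have hρη : ρ * η = s * x := by rw [hρ, hx]; ring
  have hPη : 0 < P + η ^ 2 := by positivity
  -- The coefficient of linear minimum mean square error estimation of the output from the signal.
  set α := (P + ρ * η) / (P + η ^ 2) with hα
  have hα' : α * (P + η ^ 2) = P + s * x := by rw [hα, hρη]; field_simp
  set V := (1 - α) ^ 2 * P + h ^ 2 * P + (ρ - α * η) ^ 2 + (h * η) ^ 2 with hV
  have hVd : V * (P + η ^ 2) = P * (η ^ 2 + s ^ 2 - 2 * s * x) + s ^ 2 * y ^ 2 := by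
    have e1 : V = P + s ^ 2 + α * (α * (P + η ^ 2)) - 2 * α * (P + s * x) := by
      rw [hV]; linear_combination hρ1 - hs2 - 2 * α * hρη
    rw [e1, hα']
    linear_combination (-(P + s * x)) * hα' - s ^ 2 * hr
  have hD : h ^ 2 * η ^ 2 * (P + η ^ 2) = s ^ 2 * y ^ 2 := by
    have e1 : ρ ^ 2 * η ^ 2 = s ^ 2 * x ^ 2 := by rw [← mul_pow, hρη, mul_pow]
    linear_combination η ^ 2 * hρ1 - e1 - s ^ 2 * hr - η ^ 2 * hs2
  have hfin : V / (h ^ 2 * η ^ 2) = 1 + P / (1 + h ^ 2 * P) * (1 + 1 / μ ^ 2) := by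
    rw [← mul_div_mul_right V _ hPη.ne', hVd, hD, ← hs2]
    have hy2 : y ^ 2 = μ ^ 2 * (x - s) ^ 2 := by rw [hl, mul_pow]
    have hxs : x - s ≠ 0 := by
      intro h0; exact hy0 (by rw [hl, h0, mul_zero])
    have e2 : η ^ 2 + s ^ 2 - 2 * s * x = (x - s) ^ 2 + y ^ 2 := by
      linear_combination -hr
    rw [e2, hy2]
    field_simp
    ring
  rw [← hfin]
  exact sumCapacity_le hh hη.ne' hP hρ1 hV

end

end GaussIC

theorem theorem2 (h P : ℝ) (hP : 0 ≤ P) (hh : 1 / 2 < |h + h ^ 3 * P|) :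
    (∃ m : ℝ, 0 < m ∧ ∀ μ : ℝ, GaussIC.IsTangentSlope h P μ ↔ μ = m ∨ μ = -m) ∧
    ∀ μ : ℝ, GaussIC.IsTangentSlope h P μ →
      GaussIC.sumCapacity h h P P ≤
        ((Real.logb 2 (1 + P / (1 + h ^ 2 * P) * (1 + 1 / μ ^ 2)) : ℝ) : EReal) := by
  have hh0 := GaussIC.ne_zero_of_half_lt hh
  constructor
  · obtain ⟨⟨x, y⟩, hq⟩ := GaussIC.touchingPoints_nonempty hP hh0
    have hy := GaussIC.snd_ne_zero_of_mem_curve hh0 hP hq.1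
    have hxs := sub_ne_zero.2 (GaussIC.fst_ne_sqrt_of_mem_curve hP hh hq.1)
    refine ⟨|y / (x - √(1 + h ^ 2 * P))|, abs_pos.2 (div_ne_zero hy hxs), fun μ => ?_⟩
    rw [GaussIC.isTangentSlope_iff hP hh, ← sq_eq_sq_iff_eq_or_eq_neg, sq_abs, div_pow,
      eq_div_iff (pow_ne_zero 2 hxs)]
    constructor
    · rintro ⟨⟨x', y'⟩, hq', hl⟩
      obtain ⟨rfl, hy'⟩ := GaussIC.touchingPoints_unique hP hh0 hq hq'
      rw [hy', ← mul_pow]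
      exact congrArg (· ^ 2) hl.symm
    · intro hμ
      have hy2 : (μ * (x - √(1 + h ^ 2 * P))) ^ 2 = y ^ 2 := by rw [mul_pow, hμ]
      refine ⟨(x, μ * (x - √(1 + h ^ 2 * P))), ⟨?_, ?_⟩, rfl⟩
      · rw [GaussIC.mem_usefulGenieCurve_iff, hy2]
        exact GaussIC.mem_usefulGenieCurve_iff.1 hq.1
      · simp only [hy2]
        exact hq.2
  · intro μ hμ
    obtain ⟨⟨x, y⟩, hq, hl, -⟩ := hμ
    exact GaussIC.sumCapacity_le_of_mem_curve hP hh0 hq hl
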